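/- Conventions: manifolds are smooth, Hausdorff and second countable, without boundary; $d\eta(X,Y)=X\eta(Y)-Y\eta(X)-\eta([X,Y])$; the Nijenhuis torsion of an endomorphism field $A$ of the tangent bundle is $N_A(X,Y)=A^2[X,Y]+[AX,AY]-A([AX,Y]+[X,AY])$. A \emph{quasi-Sasakian structure} on a manifold $M$ of dimension $2n+1$ consists of a smooth endomorphism field $\varphi$ of $TM$, a vector field $\xi$, a $1$-form $\eta$ and a Riemannian metric $h$ such that $\varphi^2=-\mathrm{Id}+\eta\otimes\xi$, $\eta(\xi)=1$, $h(\varphi X,\varphi Y)=h(X,Y)-\eta(X)\eta(Y)$, $N_\varphi+d\eta\otimes\xi=0$ and $d\Phi=0$, where $\Phi(X,Y)=h(X,\varphi Y)$. A \emph{quasi-Vaisman structure} on a manifold $N$ of dimension $2n+2$ is a triple $(J,g,\theta)$ where $g$ is a Riemannian metric, $J$ is a smooth endomorphism field with $J^2=-\mathrm{Id}$, $g(JX,JY)=g(X,Y)$, $N_J=0$, and $\theta$ is a closed $1$-form such that $d\Omega=d\eta\wedge\theta$, where $\Omega(X,Y)=g(X,JY)$ and $\eta=-\theta\circ J$, and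 such that the metric dual $U$ of $\theta$ satisfies $g(U,U)=1$, $\mathcal L_U g=0$ and $\mathcal L_U J=0$. \textbf{Proposition.} Let $(\varphi,\xi,\eta,h)$ be a quasi-Sasakian structure on $M$. On $M\times\mathbb R$, with coordinate $t$ on $\mathbb R$, put $$g=h+dt\otimes dt,\qquad J=\varphi-\tfrac{\partial}{\partial t}\otimes\eta+\xi\otimes dt,$$ that is, $J(X,b\,\partial_t)=(\varphi X+b\,\xi,\,-\eta(X)\,\partial_t)$. (1) $(J,g,dt)$ is a quasi-Vaisman structure on $M\times\mathbb R$. (2) For every $a>0$ the map $M\times\mathbb R\to M\times S^1$, $(x,t)\mapsto(x,e^{2\pi i t/a})$, is a surjective local diffeomorphism whose fibres are the orbits of the translations $(x,t)\mapsto(x,t+ka)$, $k\in\mathbb Z$, and $M\times S^1$ carries a quasi-Vaisman structure whose pull-back under this map is $(J,g,dt)$. (3) Let $f\colon M\to M$ be a diffeomorphism preserving $\varphi$, $\xi$, $\eta$ and $h$, and let $a>0$. The mapping torus $M_{(f,a)}=(M\times\mathbb R)/\mathbb Z$, where $k\in\mathbb Z$ acts by $(x,t)\mapsto(f^k(x),t+ka)$,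 is a Hausdorff, second countable topological space, compact if $M$ is compact, with a smooth manifold structure for which the projection $M\times\mathbb R\to M_{(f,a)}$ is a local diffeomorphism, and it carries a quasi-Vaisman structure whose pull-back under the projection is $(J,g,dt)$. -/

import Mathlib

open scoped Manifold ContDiff Topology
open Bundle

noncomputable section

namespace QuasiVaisman

/-! ### Smooth vector fields and tensor fields -/

section Tensors

variable {E : Type*} [NormedAddCommGroup E] [NormedSpace ℝ E]
  {H : Type*} [TopologicalSpace H] (I : ModelWithCorners ℝ E H)
  {M : Type*} [TopologicalSpace M] [ChartedSpace H M]

/-- A (not necessarily smooth) vector field. -/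
abbrev VField (M : Type*) [TopologicalSpace M] [ChartedSpace H M] : Type _ :=
  (x : M) → TangentSpace I x

/-- A (not necessarily smooth) `1`-form. -/
abbrev OneForm (M : Type*) [TopologicalSpace M] [ChartedSpace H M] : Type _ :=
  (x : M) → (TangentSpace I x →L[ℝ] ℝ)

/-- A (not necessarily smooth) field of endomorphisms of the tangent spaces. -/
abbrev EndField (M : Type*) [TopologicalSpace M] [ChartedSpace H M] : Type _ :=
  (x : M) → (TangentSpace I x →L[ℝ] TangentSpace I x)

/-- A (not necessarily smooth) field of bilinear forms on the tangent spaces. -/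
abbrev BilinField (M : Type*) [TopologicalSpace M] [ChartedSpace H M] : Type _ :=
  (x : M) → (TangentSpace I x →L[ℝ] TangentSpace I x →L[ℝ] ℝ)

variable {I}

/-- The vector field `X` is smooth on the set `U`. -/
def SmoothOn [IsManifold I ∞ M] (X : VField I M) (U : Set M) : Prop :=
  ContMDiffOn I (I.prod 𝓘(ℝ, E)) ∞ (fun x => TotalSpace.mk' E x (X x)) U

/-- The `1`-form `η` is smooth, as a section of the cotangent bundle. -/
def SmoothOneForm [IsManifold I ∞ M] (η : OneForm I M) : Prop :=
  ContMDiff I (I.prod 𝓘(ℝ, E →L[ℝ] ℝ)) ∞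
    (fun x => TotalSpace.mk' (E →L[ℝ] ℝ) (E := fun x : M => TangentSpace I x →L[ℝ] ℝ) x (η x))

/-- The field of endomorphisms `φ` is smooth, as a section of `Hom(TM, TM)`. -/
def SmoothEnd [IsManifold I ∞ M] (φ : EndField I M) : Prop :=
  ContMDiff I (I.prod 𝓘(ℝ, E →L[ℝ] E)) ∞
    (fun x => TotalSpace.mk' (E →L[ℝ] E)
      (E := fun x : M => TangentSpace I x →L[ℝ] TangentSpace I x) x (φ x))

/-- `g` is (the underlying bilinear field of) a smooth Riemannian metric. -/
def IsRiemannianMetric [IsManifold I ∞ M] (g : BilinField I M) : Prop :=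
  ∃ G : ContMDiffRiemannianMetric I ∞ E (fun x : M => TangentSpace I x), G.inner = g

/-! ### Differential operators, through their values on vector fields -/

/-- The derivative `X(u)` of the function `u` in the direction of `X`, at `p`. -/
def dirDeriv (X : VField I M) (u : M → ℝ) (p : M) : ℝ :=
  mfderiv I 𝓘(ℝ, ℝ) u p (X p)

/-- `φ X` for an endomorphism field `φ` and a vector field `X`. -/
def app (φ : EndField I M) (X : VField I M) : VField I M := fun x => φ x (X x)

/-- The exterior derivative of a `1`-form:
`dη(X, Y) = X(η(Y)) - Y(η(X)) - η([X, Y])`, at `p`. -/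
def dOne (η : OneForm I M) (X Y : VField I M) (p : M) : ℝ :=
  dirDeriv X (fun x => η x (Y x)) p - dirDeriv Y (fun x => η x (X x)) p
    - η p (VectorField.mlieBracket I X Y p)

/-- The exterior derivative of a `2`-form `w`:
`dw(X, Y, Z) = X(w(Y, Z)) + Y(w(Z, X)) + Z(w(X, Y)) - w([X, Y], Z) - w([Y, Z], X) - w([Z, X], Y)`,
at `p`. -/
def dTwo (w : (x : M) → TangentSpace I x → TangentSpace I x → ℝ) (X Y Z : VField I M) (p : M) : ℝ :=
  dirDeriv X (fun x => w x (Y x) (Z x)) p + dirDeriv Y (fun x => w x (Z x) (X x)) p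
    + dirDeriv Z (fun x => w x (X x) (Y x)) p
    - w p (VectorField.mlieBracket I X Y p) (Z p)
    - w p (VectorField.mlieBracket I Y Z p) (X p)
    - w p (VectorField.mlieBracket I Z X p) (Y p)

/-- The value on `(X, Y, Z)`, at `p`, of the `3`-form `dη ∧ θ`. -/
def dOneWedge (η θ : OneForm I M) (X Y Z : VField I M) (p : M) : ℝ :=
  dOne η X Y p * θ p (Z p) + dOne η Y Z p * θ p (X p) + dOne η Z X p * θ p (Y p)

/-- The Nijenhuis torsion
`N_φ(X, Y) = φ²[X, Y] + [φX, φY] - φ([φX, Y] + [X, φY])`, at `p`. -/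
def nijenhuis (φ : EndField I M) (X Y : VField I M) (p : M) : TangentSpace I p :=
  φ p (φ p (VectorField.mlieBracket I X Y p))
    + VectorField.mlieBracket I (app φ X) (app φ Y) p
    - φ p (VectorField.mlieBracket I (app φ X) Y p + VectorField.mlieBracket I X (app φ Y) p)

/-- The Lie derivative `(L_U J)(X) = [U, J X] - J [U, X]`, at `p`. -/
def lieDerivEnd (U : VField I M) (J : EndField I M) (X : VField I M) (p : M) : TangentSpace I p :=
  VectorField.mlieBracket I U (app J X) p - J p (VectorField.mlieBracket I U X p)

/-- The Lie derivative `(L_U g)(X, Y) = U(g(X, Y)) - g([U, X], Y) - g(X, [U, Y])`, at `p`. -/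
def lieDerivBilin (U : VField I M) (g : BilinField I M) (X Y : VField I M) (p : M) : ℝ :=
  dirDeriv U (fun x => g x (X x) (Y x)) p
    - g p (VectorField.mlieBracket I U X p) (Y p) - g p (X p) (VectorField.mlieBracket I U Y p)

/-- The fundamental `2`-form `(X, Y) ↦ g(X, φ Y)`. -/
def fundForm (φ : EndField I M) (g : BilinField I M) :
    (x : M) → TangentSpace I x → TangentSpace I x → ℝ :=
  fun x v w => g x v (φ x w)

/-- `- θ ∘ J`. -/
def antiForm (θ : OneForm I M) (J : EndField I M) : OneForm I M := fun x => -(θ x ∘L J x)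

/-! ### Quasi-Sasakian structures -/

/-- `(φ, ξ, η, h)` is an almost contact metric structure. -/
structure IsAlmostContactMetric [IsManifold I ∞ M]
    (φ : EndField I M) (ξ : VField I M) (η : OneForm I M) (h : BilinField I M) : Prop where
  odd_dim : ∃ n : ℕ, Module.finrank ℝ E = 2 * n + 1
  smooth_phi : SmoothEnd φ
  smooth_xi : SmoothOn ξ Set.univ
  smooth_eta : SmoothOneForm η
  metric : IsRiemannianMetric h
  phi_sq : ∀ (x : M) (v : TangentSpace I x), φ x (φ x v) = -v + η x v • ξ x
  eta_xi : ∀ x : M, η x (ξ x) = 1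
  compat : ∀ (x : M) (v w : TangentSpace I x), h x (φ x v) (φ x w) = h x v w - η x v * η x w

/-- `(φ, ξ, η, h)` is a quasi-Sasakian structure: an almost contact metric structure
with `N_φ + dη ⊗ ξ = 0` and `dΦ = 0`, where `Φ(X, Y) = h(X, φ Y)`. -/
structure IsQuasiSasakian [IsManifold I ∞ M]
    (φ : EndField I M) (ξ : VField I M) (η : OneForm I M) (h : BilinField I M) : Prop
    extends IsAlmostContactMetric φ ξ η h where
  normal : ∀ U : Set M, IsOpen U → ∀ X Y : VField I M, SmoothOn X U → SmoothOn Y U →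
    ∀ p ∈ U, nijenhuis φ X Y p + dOne η X Y p • ξ p = 0
  closed : ∀ U : Set M, IsOpen U → ∀ X Y Z : VField I M,
    SmoothOn X U → SmoothOn Y U → SmoothOn Z U →
    ∀ p ∈ U, dTwo (fundForm φ h) X Y Z p = 0

/-! ### Quasi-Vaisman structures -/

/-- `(J, g)` is a Hermitian structure: an almost Hermitian structure with `N_J = 0`. -/
structure IsHermitian [IsManifold I ∞ M] (J : EndField I M) (g : BilinField I M) : Prop where
  even_dim : ∃ n : ℕ, Module.finrank ℝ E = 2 * (n + 1)
  smooth_J : SmoothEnd J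
  metric : IsRiemannianMetric g
  J_sq : ∀ (x : M) (v : TangentSpace I x), J x (J x v) = -v
  compat : ∀ (x : M) (v w : TangentSpace I x), g x (J x v) (J x w) = g x v w
  integrable : ∀ U : Set M, IsOpen U → ∀ X Y : VField I M, SmoothOn X U → SmoothOn Y U →
    ∀ p ∈ U, nijenhuis J X Y p = 0

/-- `(J, g, θ)` is a quasi-Vaisman structure: `(J, g)` is Hermitian, `θ` is closed,
`dΩ = dη ∧ θ` with `Ω(X, Y) = g(X, J Y)` and `η = - θ ∘ J`, and the metric dual `V` of `θ`
is unitary, Killing and satisfies `L_V J = 0`. -/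
structure IsQuasiVaisman [IsManifold I ∞ M]
    (J : EndField I M) (g : BilinField I M) (θ : OneForm I M) : Prop
    extends IsHermitian J g where
  smooth_theta : SmoothOneForm θ
  closed : ∀ U : Set M, IsOpen U → ∀ X Y : VField I M, SmoothOn X U → SmoothOn Y U →
    ∀ p ∈ U, dOne θ X Y p = 0
  d_fundForm : ∀ U : Set M, IsOpen U → ∀ X Y Z : VField I M,
    SmoothOn X U → SmoothOn Y U → SmoothOn Z U →
    ∀ p ∈ U, dTwo (fundForm J g) X Y Z p = dOneWedge (antiForm θ J) θ X Y Z p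
  dual : ∃ V : VField I M, SmoothOn V Set.univ ∧
    (∀ (x : M) (v : TangentSpace I x), g x (V x) v = θ x v) ∧
    (∀ x : M, g x (V x) (V x) = 1) ∧
    (∀ U : Set M, IsOpen U → ∀ X Y : VField I M, SmoothOn X U → SmoothOn Y U →
      ∀ p ∈ U, lieDerivBilin V g X Y p = 0) ∧
    (∀ U : Set M, IsOpen U → ∀ X : VField I M, SmoothOn X U →
      ∀ p ∈ U, lieDerivEnd V J X p = 0)

end Tensors

/-! ### The structure on `M × ℝ` -/

section Product

variable {E : Type*} [NormedAddCommGroup E] [NormedSpace ℝ E]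
  {H : Type*} [TopologicalSpace H] {I : ModelWithCorners ℝ E H}
  {M : Type*} [TopologicalSpace M] [ChartedSpace H M]

/-- The projection `T_(x,t)(M × ℝ) = T_x M × ℝ → T_x M`. -/
def horiz (p : M × ℝ) : TangentSpace (I.prod 𝓘(ℝ, ℝ)) p →L[ℝ] TangentSpace I p.1 :=
  ContinuousLinearMap.fst ℝ (TangentSpace I p.1) (TangentSpace 𝓘(ℝ, ℝ) p.2)

/-- The `1`-form `dt` on `M × ℝ`: the projection `T_(x,t)(M × ℝ) = T_x M × ℝ → ℝ`. -/
def dt : OneForm (I.prod 𝓘(ℝ, ℝ)) (M × ℝ) := fun p =>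
  ContinuousLinearMap.snd ℝ (TangentSpace I p.1) (TangentSpace 𝓘(ℝ, ℝ) p.2)

/-- The vector field `∂/∂t` on `M × ℝ`. -/
def ddt : VField (I.prod 𝓘(ℝ, ℝ)) (M × ℝ) := fun p =>
  ContinuousLinearMap.inr ℝ (TangentSpace I p.1) (TangentSpace 𝓘(ℝ, ℝ) p.2) (1 : ℝ)

/-- The inclusion `T_x M → T_x M × ℝ = T_(x,t)(M × ℝ)`. -/
def lift (p : M × ℝ) : TangentSpace I p.1 →L[ℝ] TangentSpace (I.prod 𝓘(ℝ, ℝ)) p :=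
  ContinuousLinearMap.inl ℝ (TangentSpace I p.1) (TangentSpace 𝓘(ℝ, ℝ) p.2)

/-- The endomorphism field `J = φ - ∂/∂t ⊗ η + ξ ⊗ dt` on `M × ℝ`. -/
def prodJ (φ : EndField I M) (ξ : VField I M) (η : OneForm I M) :
    EndField (I.prod 𝓘(ℝ, ℝ)) (M × ℝ) := fun p =>
  lift p ∘L φ p.1 ∘L horiz p - (η p.1 ∘L horiz p).smulRight (ddt p)
    + (dt (I := I) p).smulRight (lift p (ξ p.1))

/-- The metric `g = h + dt ⊗ dt` on `M × ℝ`. -/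
def prodMetric (h : BilinField I M) : BilinField (I.prod 𝓘(ℝ, ℝ)) (M × ℝ) := fun p =>
  ContinuousLinearMap.precomp ℝ (horiz p) ∘L h p.1 ∘L horiz p
    + (dt (I := I) p).smulRight (dt (I := I) p)

end Product

/-! ### Structures related by a map -/

section Pullback

variable {E : Type*} [NormedAddCommGroup E] [NormedSpace ℝ E]
  {H : Type*} [TopologicalSpace H] {I : ModelWithCorners ℝ E H}
  {M : Type*} [TopologicalSpace M] [ChartedSpace H M]
  {E' : Type*} [NormedAddCommGroup E'] [NormedSpace ℝ E']
  {H' : Type*} [TopologicalSpace H'] {I' : ModelWithCorners ℝ E' H'}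
  {M' : Type*} [TopologicalSpace M'] [ChartedSpace H' M']

/-- `(J, g, θ)` is the pull-back of `(J', g', θ')` along `q`:
`dq ∘ J = J' ∘ dq`, `g = q^* g'` and `θ = q^* θ'`. -/
structure IsPullback (q : M → M') (J : EndField I M) (g : BilinField I M) (θ : OneForm I M)
    (J' : EndField I' M') (g' : BilinField I' M') (θ' : OneForm I' M') : Prop where
  J_eq : ∀ (x : M) (v : TangentSpace I x),
    mfderiv I I' q x (J x v) = J' (q x) (mfderiv I I' q x v)
  g_eq : ∀ (x : M) (v w : TangentSpace I x),
    g x v w = g' (q x) (mfderiv I I' q x v) (mfderiv I I' q x w)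
  theta_eq : ∀ (x : M) (v : TangentSpace I x), θ x v = θ' (q x) (mfderiv I I' q x v)

/-- The map `f` preserves the almost contact metric structure `(φ, ξ, η, h)`. -/
structure Preserves (f : M → M) (φ : EndField I M) (ξ : VField I M) (η : OneForm I M)
    (h : BilinField I M) : Prop where
  phi_eq : ∀ (x : M) (v : TangentSpace I x),
    mfderiv I I f x (φ x v) = φ (f x) (mfderiv I I f x v)
  xi_eq : ∀ x : M, mfderiv I I f x (ξ x) = ξ (f x)
  eta_eq : ∀ (x : M) (v : TangentSpace I x), η x v = η (f x) (mfderiv I I f x v)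
  h_eq : ∀ (x : M) (v w : TangentSpace I x),
    h x v w = h (f x) (mfderiv I I f x v) (mfderiv I I f x w)

end Pullback

/-! ### Mapping tori and the product with a circle -/

section MappingTorus

variable {M : Type*}

/-- The action of `ℤ` on `M × ℝ` given by `ρ(k, (x, t)) = (f^k x, t + k a)`. -/
@[reducible] def torusAction (f : Equiv.Perm M) (a : ℝ) : AddAction ℤ (M × ℝ) where
  vadd k p := ((f ^ k) p.1, p.2 + k * a)
  zero_vadd p := by
    change ((f ^ (0 : ℤ)) p.1, p.2 + ((0 : ℤ) : ℝ) * a) = p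
    simp
  add_vadd k l p := by
    change ((f ^ (k + l)) p.1, p.2 + ((k + l : ℤ) : ℝ) * a)
      = ((f ^ k) ((f ^ l) p.1), p.2 + l * a + k * a)
    rw [zpow_add, Equiv.Perm.mul_apply]
    push_cast
    congr 1
    ring

/-- The mapping torus `M_(f, a) = (M × ℝ) / ℤ`. -/
def MappingTorus (f : Equiv.Perm M) (a : ℝ) : Type _ :=
  Quotient (@AddAction.orbitRel ℤ (M × ℝ) _ (torusAction f a))

/-- The quotient map `M × ℝ → M_(f, a)`. -/
def MappingTorus.proj (f : Equiv.Perm M) (a : ℝ) : M × ℝ → MappingTorus f a :=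
  Quotient.mk _

/-- The quotient topology. -/
instance [TopologicalSpace M] (f : Equiv.Perm M) (a : ℝ) : TopologicalSpace (MappingTorus f a) :=
  inferInstanceAs
    (TopologicalSpace (Quotient (@AddAction.orbitRel ℤ (M × ℝ) _ (torusAction f a))))

/-- The map `M × ℝ → M × S¹`, `(x, t) ↦ (x, exp(2πit/a))`. -/
def circleProj (a : ℝ) : M × ℝ → M × Circle :=
  fun p => (p.1, Circle.exp (2 * Real.pi * p.2 / a))

end MappingTorus

end QuasiVaisman

end

/-!
Everything is local, so the equations on `M × ℝ` are checked in coordinates, and the quotients are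
then treated by descent.

**Coordinates.** All the differential operators involved (`dη`, `dΦ`, the Nijenhuis torsion, Lie
derivatives) are natural under local diffeomorphisms: they take related fields to related fields
(`nijenhuis_eq_of_related` and its companions). Since they are tensorial, on a vector space they
are given by the derivatives of the tensor fields alone (`nijenhuis_vectorSpace` and its
companions). A quasi-Sasakian structure thus becomes, in a chart, a set of tensors and of first
derivatives satisfying algebraic equations (`CoordExpr`, `NormalJet`); one gets these by testing
the defining equations on coordinate fields.

**The product with the line.** Nothing depends on `t`, so `∂/∂t` is Killing and preserves `J`, and
`dt` is closed. From `Ω = Φ + η ∧ dt` and `dΦ = 0` one gets `dΩ = dη ∧ dt`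
(`CoordExpr.dTwo_fundForm`). The torsion of `J` reduces to the tensors `N_φ + dη ⊗ ξ`,
`dη(φ ·, ·) + dη(·, φ ·)`, `L_ξ φ` and `L_ξ η`. The first vanishes by assumption, and the
vanishing of the others follows from it by algebra (`NormalJet.nijenhuis_spaceJ`). This gives
`IsQuasiSasakian.isQuasiVaisman_prod`.

**Quotients.** Let `q` be a surjective local diffeomorphism whose fibres are permuted transitively
by maps which preserve `(J, g, dt)`. Then the tensors descend (`exists_isPullback`), and the
result is quasi-Vaisman because all the conditions are local
(`IsQuasiVaisman.of_isPullback`). For an automorphism `f` of the quasi-Sasakian structure the maps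
`(x, t) ↦ (f^k x, t + k a)` preserve the structure on `M × ℝ`, so this applies to `M × S¹`
(with `f = id`) and to the mapping torus. In the latter case the action of `ℤ` is free and properly
discontinuous, which gives the topological properties of the quotient, and its charts are
compatible because the deck transformations are smooth (`isManifold_quotient`).

The tangent space at every point is by definition the model space `E`. Vectors at different points
are compared through ascriptions `(v : E)`; such equations are chained as terms, since rewriting
does not see through this identification.
-/

noncomputable section

namespace QuasiVaisman

open VectorField

/-! ### Testing smoothness of tensor fields on vector fields -/

section Testing

variable {E : Type*} [NormedAddCommGroup E] [NormedSpace ℝ E]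
  {H : Type*} [TopologicalSpace H] {I : ModelWithCorners ℝ E H}
  {M : Type*} [TopologicalSpace M] [ChartedSpace H M]

/-- Smoothness of a family of linear maps on a finite-dimensional space can be tested on
vectors. -/
lemma contMDiffAt_clm_of_apply {F₁ F₂ : Type*} [NormedAddCommGroup F₁] [NormedSpace ℝ F₁]
    [NormedAddCommGroup F₂] [NormedSpace ℝ F₂] [FiniteDimensional ℝ F₁]
    {f : M → F₁ →L[ℝ] F₂} {x₀ : M}
    (h : ∀ v, ContMDiffAt I 𝓘(ℝ, F₂) ∞ (fun x => f x v) x₀) :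
    ContMDiffAt I 𝓘(ℝ, F₁ →L[ℝ] F₂) ∞ f x₀ := by
  let b := Module.finBasis ℝ F₁
  let c : Fin (Module.finrank ℝ F₁) → F₁ →L[ℝ] ℝ := fun i => (b.coord i).toContinuousLinearMap
  have hf : f = fun x => ∑ i, ContinuousLinearMap.smulRightL ℝ F₁ F₂ (c i) (f x (b i)) := by
    funext x
    ext v
    conv_lhs => rw [← b.sum_repr v, map_sum]
    simp [c]
  rw [hf]
  refine contMDiffAt_finsetSum fun i _ => ?_
  exact (ContinuousLinearMap.contMDiff
    (ContinuousLinearMap.smulRightL ℝ F₁ F₂ (c i))).contMDiffAt.comp x₀ (h (b i))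

variable [IsManifold I ∞ M]

/-- The vector field `X` is smooth at `x`. -/
def SmoothFieldAt (X : VField I M) (x : M) : Prop :=
  ContMDiffAt I (I.prod 𝓘(ℝ, E)) ∞ (fun x => TotalSpace.mk' E x (X x)) x

/-- The `1`-form `η` is smooth at `x`. -/
def SmoothOneFormAt (η : OneForm I M) (x : M) : Prop :=
  ContMDiffAt I (I.prod 𝓘(ℝ, E →L[ℝ] ℝ)) ∞
    (fun x => TotalSpace.mk' (E →L[ℝ] ℝ) (E := fun x : M => TangentSpace I x →L[ℝ] ℝ) x (η x)) x

/-- The field of endomorphisms `φ` is smooth at `x`. -/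
def SmoothEndAt (φ : EndField I M) (x : M) : Prop :=
  ContMDiffAt I (I.prod 𝓘(ℝ, E →L[ℝ] E)) ∞
    (fun x => TotalSpace.mk' (E →L[ℝ] E)
      (E := fun x : M => TangentSpace I x →L[ℝ] TangentSpace I x) x (φ x)) x

/-- The field of bilinear forms `g` is smooth at `x`. -/
def SmoothBilinAt (g : BilinField I M) (x : M) : Prop :=
  ContMDiffAt I (I.prod 𝓘(ℝ, E →L[ℝ] E →L[ℝ] ℝ)) ∞
    (fun x => TotalSpace.mk' (E →L[ℝ] E →L[ℝ] ℝ)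
      (E := fun x : M => TangentSpace I x →L[ℝ] TangentSpace I x →L[ℝ] ℝ) x (g x)) x

lemma SmoothOn.smoothFieldAt {X : VField I M} {U : Set M} (hX : SmoothOn X U) (hU : IsOpen U)
    {x : M} (hx : x ∈ U) : SmoothFieldAt X x :=
  (hX x hx).contMDiffAt (hU.mem_nhds hx)

omit [IsManifold I ∞ M] in
/-- A function is smooth if and only if it is smooth as a section of the trivial line bundle. -/
lemma contMDiffAt_trivial_iff {f : M → ℝ} {x : M} :
    ContMDiffAt I (I.prod 𝓘(ℝ, ℝ)) ∞ (fun x => TotalSpace.mk' ℝ (E := Bundle.Trivial M ℝ) x (f x)) x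
      ↔ ContMDiffAt I 𝓘(ℝ, ℝ) ∞ f x :=
  Bundle.contMDiffAt_section x

lemma SmoothOneFormAt.apply {η : OneForm I M} {X : VField I M} {x : M}
    (hη : SmoothOneFormAt η x) (hX : SmoothFieldAt X x) :
    ContMDiffAt I 𝓘(ℝ, ℝ) ∞ (fun y => η y (X y)) x :=
  contMDiffAt_trivial_iff.1 (ContMDiffAt.clm_bundle_apply (E₂ := Bundle.Trivial M ℝ) hη hX)

lemma SmoothEndAt.apply {φ : EndField I M} {X : VField I M} {x : M}
    (hφ : SmoothEndAt φ x) (hX : SmoothFieldAt X x) : SmoothFieldAt (app φ X) x :=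
  ContMDiffAt.clm_bundle_apply hφ hX

lemma SmoothBilinAt.apply {g : BilinField I M} {X Y : VField I M} {x : M}
    (hg : SmoothBilinAt g x) (hX : SmoothFieldAt X x) (hY : SmoothFieldAt Y x) :
    ContMDiffAt I 𝓘(ℝ, ℝ) ∞ (fun y => g y (X y) (Y y)) x :=
  contMDiffAt_trivial_iff.1 (ContMDiffAt.clm_bundle_apply₂ (E₃ := Bundle.Trivial M ℝ) hg hX hY)

section Hom

variable {F₂ : Type*} [NormedAddCommGroup F₂] [NormedSpace ℝ F₂] {E₂ : M → Type*}
  [TopologicalSpace (TotalSpace F₂ E₂)] [∀ x, TopologicalSpace (E₂ x)]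
  [∀ x, AddCommGroup (E₂ x)] [∀ x, Module ℝ (E₂ x)]
  [FiberBundle F₂ E₂] [VectorBundle ℝ F₂ E₂]
  [∀ x, IsTopologicalAddGroup (E₂ x)] [∀ x, ContinuousSMul ℝ (E₂ x)]

/-- A field of linear maps out of the tangent spaces is smooth if it sends smooth vector fields
to smooth sections: it suffices to test the fields which are constant in a trivialization. -/
lemma contMDiffAt_hom_of_apply [FiniteDimensional ℝ E]
    {ϕ : (x : M) → TangentSpace I x →L[ℝ] E₂ x} {x₀ : M}
    (h : ∀ X : VField I M, SmoothFieldAt X x₀ →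
      ContMDiffAt I (I.prod 𝓘(ℝ, F₂)) ∞ (fun x => TotalSpace.mk' F₂ x (ϕ x (X x))) x₀) :
    ContMDiffAt I (I.prod 𝓘(ℝ, E →L[ℝ] F₂)) ∞
      (fun x => TotalSpace.mk' (E →L[ℝ] F₂) (E := fun x : M => TangentSpace I x →L[ℝ] E₂ x) x (ϕ x))
      x₀ := by
  rw [contMDiffAt_hom_bundle]
  refine ⟨contMDiffAt_id, contMDiffAt_clm_of_apply fun v => ?_⟩
  let e := trivializationAt E (TangentSpace I : M → Type _) x₀
  have he : e.baseSet ∈ 𝓝 x₀ := e.open_baseSet.mem_nhds (mem_baseSet_trivializationAt E _ x₀)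
  have hX : SmoothFieldAt (fun x => e.symmL ℝ x v : VField I M) x₀ := by
    refine (Bundle.contMDiffAt_section x₀).2 ?_
    refine (contMDiffAt_const (c := v)).congr_of_eventuallyEq ?_
    filter_upwards [he] with x hx
    change (e ⟨x, e.symmL ℝ x v⟩).2 = v
    rw [e.symmL_apply hx, e.apply_mk_symm hx]
  have := (Bundle.contMDiffAt_section x₀).1 (h _ hX)
  refine this.congr_of_eventuallyEq ?_
  have he₂ := (trivializationAt F₂ E₂ x₀).open_baseSet.mem_nhds
    (mem_baseSet_trivializationAt F₂ E₂ x₀)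
  filter_upwards [he₂] with x hx₂
  simp only [ContinuousLinearMap.inCoordinates, ContinuousLinearMap.comp_apply]
  rw [Trivialization.continuousLinearMapAt_apply, Trivialization.linearMapAt_apply, if_pos hx₂]

end Hom

variable [FiniteDimensional ℝ E]

lemma smoothOneFormAt_of_apply {η : OneForm I M} {x : M}
    (h : ∀ X : VField I M, SmoothFieldAt X x → ContMDiffAt I 𝓘(ℝ, ℝ) ∞ (fun y => η y (X y)) x) :
    SmoothOneFormAt η x :=
  contMDiffAt_hom_of_apply (E₂ := Bundle.Trivial M ℝ) (F₂ := ℝ) fun X hX =>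
    contMDiffAt_trivial_iff.2 (h X hX)

lemma smoothEndAt_of_apply {φ : EndField I M} {x : M}
    (h : ∀ X : VField I M, SmoothFieldAt X x → SmoothFieldAt (app φ X) x) :
    SmoothEndAt φ x :=
  contMDiffAt_hom_of_apply fun X hX => h X hX

lemma smoothBilinAt_of_apply {g : BilinField I M} {x : M}
    (h : ∀ X Y : VField I M, SmoothFieldAt X x → SmoothFieldAt Y x →
      ContMDiffAt I 𝓘(ℝ, ℝ) ∞ (fun y => g y (X y) (Y y)) x) :
    SmoothBilinAt g x :=
  contMDiffAt_hom_of_apply (F₂ := E →L[ℝ] ℝ) (E₂ := fun x : M => TangentSpace I x →L[ℝ] ℝ)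
    fun X hX => smoothOneFormAt_of_apply fun Y hY => h X Y hX hY

end Testing

/-! ### Fields related by a local diffeomorphism -/

section Related

variable {E : Type*} [NormedAddCommGroup E] [NormedSpace ℝ E]
  {H : Type*} [TopologicalSpace H] {I : ModelWithCorners ℝ E H}
  {M : Type*} [TopologicalSpace M] [ChartedSpace H M]
  {E' : Type*} [NormedAddCommGroup E'] [NormedSpace ℝ E']
  {H' : Type*} [TopologicalSpace H'] {I' : ModelWithCorners ℝ E' H'}
  {M' : Type*} [TopologicalSpace M'] [ChartedSpace H' M']

variable (I I') in
/-- `q` and `s` are local diffeomorphisms, inverse to each other near `x` and `x'`. -/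
structure LocalInverse (q : M → M') (s : M' → M) (x : M) (x' : M') : Prop where
  map_eq : q x = x'
  inv_eq : s x' = x
  diffeo : IsLocalDiffeomorphAt I I' ∞ q x
  diffeo_inv : IsLocalDiffeomorphAt I' I ∞ s x'
  left_inv : ∀ᶠ y in 𝓝 x, s (q y) = y
  right_inv : ∀ᶠ y in 𝓝 x', q (s y) = y

lemma LocalInverse.symm {q : M → M'} {s : M' → M} {x : M} {x' : M'}
    (h : LocalInverse I I' q s x x') : LocalInverse I' I s q x' x :=
  ⟨h.inv_eq, h.map_eq, h.diffeo_inv, h.diffeo, h.right_inv, h.left_inv⟩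

lemma exists_localInverse {q : M → M'} {x : M} (h : IsLocalDiffeomorphAt I I' ∞ q x) :
    ∃ s, LocalInverse I I' q s x (q x) :=
  ⟨h.localInverse, rfl, h.localInverse_left_inv h.localInverse_mem_target, h,
    h.localInverse_isLocalDiffeomorphAt, h.localInverse_eventuallyEq_left,
    h.localInverse_eventuallyEq_right⟩

lemma eventually_isLocalDiffeomorphAt {q : M → M'} {x : M}
    (h : IsLocalDiffeomorphAt I I' ∞ q x) : ∀ᶠ y in 𝓝 x, IsLocalDiffeomorphAt I I' ∞ q y := by
  obtain ⟨Φ, hx, hq⟩ := h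
  filter_upwards [Φ.open_source.mem_nhds hx] with y hy using ⟨Φ, hy, hq⟩

lemma _root_.IsLocalDiffeomorphAt.isInvertible_mfderiv {q : M → M'} {x : M}
    (h : IsLocalDiffeomorphAt I I' ∞ q x) : (mfderiv I I' q x).IsInvertible :=
  ⟨h.mfderivToContinuousLinearEquiv (by simp), rfl⟩

lemma LocalInverse.eventually {q : M → M'} {s : M' → M} {x : M} {x' : M'}
    (h : LocalInverse I I' q s x x') : ∀ᶠ y in 𝓝 x, LocalInverse I I' q s y (q y) := by
  have hc : Filter.Tendsto q (𝓝 x) (𝓝 x') := h.map_eq ▸ h.diffeo.contMDiffAt.continuousAt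
  filter_upwards [h.left_inv, h.left_inv.eventually_nhds, eventually_isLocalDiffeomorphAt h.diffeo,
    hc.eventually (eventually_isLocalDiffeomorphAt h.diffeo_inv),
    hc.eventually h.right_inv.eventually_nhds] with y h1 h2 h3 h4 h5
  exact ⟨rfl, h1, h3, h4, h2, h5⟩

/-- The differentials of mutually inverse local diffeomorphisms are inverse to each other. -/
lemma LocalInverse.mfderiv_mfderiv {q : M → M'} {s : M' → M} {x : M}
    (h : LocalInverse I I' q s x (q x)) (v : E) :
    (mfderiv I' I s (q x) (mfderiv I I' q x v : E') : E) = v := by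
  have h1 : mfderiv I I (s ∘ q) x = (mfderiv I' I s (q x)).comp (mfderiv I I' q x) :=
    mfderiv_comp x (h.diffeo_inv.mdifferentiableAt (by simp))
      (h.diffeo.mdifferentiableAt (by simp))
  have h2 : mfderiv I I (s ∘ q) x = mfderiv I I (id : M → M) x :=
    Filter.EventuallyEq.mfderiv_eq h.left_inv
  have h3 := congrArg (fun L : E →L[ℝ] E => L v) (h1.symm.trans h2)
  refine h3.trans ?_
  exact congrArg (fun L : E →L[ℝ] E => L v) (mfderiv_id (I := I) (x := x))

lemma LocalInverse.mfderiv_mfderiv' {q : M → M'} {s : M' → M} {x : M}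
    (h : LocalInverse I I' q s x (q x)) (v : E') :
    (mfderiv I I' q x (mfderiv I' I s (q x) v : E) : E') = v := by
  obtain ⟨w, hw⟩ := h.diffeo.isInvertible_mfderiv.bijective.2 v
  have hw' : (mfderiv I I' q x (w : E) : E') = v := hw
  rw [← hw', h.mfderiv_mfderiv w]

variable (I I') in
/-- The vector fields `X` and `X'` are related by `q` near `x`. -/
def RelField (q : M → M') (x : M) (X : VField I M) (X' : VField I' M') : Prop :=
  ∀ᶠ y in 𝓝 x, mfderiv I I' q y (X y) = X' (q y)

variable (I I') in
/-- Near `x`, the `1`-form `η` is the pull-back of `η'` along `q`. -/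
def RelForm (q : M → M') (x : M) (η : OneForm I M) (η' : OneForm I' M') : Prop :=
  ∀ᶠ y in 𝓝 x, ∀ v, η y v = η' (q y) (mfderiv I I' q y v)

variable (I I') in
/-- The endomorphism fields `φ` and `φ'` are intertwined by the differential of `q` near `x`. -/
def RelEnd (q : M → M') (x : M) (φ : EndField I M) (φ' : EndField I' M') : Prop :=
  ∀ᶠ y in 𝓝 x, ∀ v, mfderiv I I' q y (φ y v) = φ' (q y) (mfderiv I I' q y v)

variable (I I') in
/-- Near `x`, the field of bilinear forms `g` is the pull-back of `g'` along `q`. -/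
def RelBilin (q : M → M') (x : M) (g : BilinField I M) (g' : BilinField I' M') : Prop :=
  ∀ᶠ y in 𝓝 x, ∀ v w, g y v w = g' (q y) (mfderiv I I' q y v) (mfderiv I I' q y w)

variable {q : M → M'} {s : M' → M} {x : M} {x' : M'}

/-- A property which holds near `x` holds near `x'` at the image of the local inverse. -/
lemma LocalInverse.eventually_inv (h : LocalInverse I I' q s x x') {P : M' → Prop}
    (hP : ∀ᶠ y in 𝓝 x, LocalInverse I I' q s y (q y) → P (q y)) : ∀ᶠ y in 𝓝 x', P y := by
  have hc : Filter.Tendsto s (𝓝 x') (𝓝 x) := h.inv_eq ▸ h.diffeo_inv.contMDiffAt.continuousAt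
  filter_upwards [hc.eventually hP, hc.eventually h.eventually, h.right_inv] with y h1 h2 h3
  simpa only [h3] using h1 h2

lemma RelField.symm {X : VField I M} {X' : VField I' M'} (hX : RelField I I' q x X X')
    (h : LocalInverse I I' q s x x') : RelField I' I s x' X' X := by
  refine h.eventually_inv (hX.mono fun y hy hl => ?_)
  have key : (mfderiv I' I s (q y) (X' (q y)) : E) = X y := by
    rw [← hy]; exact hl.mfderiv_mfderiv _
  have aux : ∀ a b : M, a = b → (X a : E) = X b := by rintro a _ rfl; rfl
  exact key.trans (aux _ _ hl.inv_eq.symm)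

lemma RelForm.symm {η : OneForm I M} {η' : OneForm I' M'} (hη : RelForm I I' q x η η')
    (h : LocalInverse I I' q s x x') : RelForm I' I s x' η' η := by
  refine h.eventually_inv (hη.mono fun y hy hl v => ?_)
  have aux : ∀ (a b : M) (w : E), a = b → η a w = η b w := by rintro a _ w rfl; rfl
  have h1 := hy (mfderiv I' I s (q y) v : E)
  have h2 : (mfderiv I I' q y (mfderiv I' I s (q y) v : E) : E') = v := hl.mfderiv_mfderiv' v
  have h3 := congrArg (fun w : E' => η' (q y) w) h2
  exact h3.symm.trans (h1.symm.trans (aux _ _ _ hl.inv_eq.symm))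

lemma RelEnd.symm {φ : EndField I M} {φ' : EndField I' M'} (hφ : RelEnd I I' q x φ φ')
    (h : LocalInverse I I' q s x x') : RelEnd I' I s x' φ' φ := by
  refine h.eventually_inv (hφ.mono fun y hy hl v => ?_)
  have aux : ∀ (a b : M) (w : E), a = b → (φ a w : E) = φ b w := by rintro a _ w rfl; rfl
  have h1 := hy (mfderiv I' I s (q y) v : E)
  have h2 : (mfderiv I I' q y (mfderiv I' I s (q y) v : E) : E') = v := hl.mfderiv_mfderiv' v
  have h3 := congrArg (fun w : E' => (mfderiv I' I s (q y) (φ' (q y) w) : E)) h2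
  have h4 := congrArg (fun w : E' => (mfderiv I' I s (q y) w : E)) h1
  exact h3.symm.trans (h4.symm.trans ((hl.mfderiv_mfderiv _).trans
    (aux _ _ _ hl.inv_eq.symm)))

lemma RelBilin.symm {g : BilinField I M} {g' : BilinField I' M'} (hg : RelBilin I I' q x g g')
    (h : LocalInverse I I' q s x x') : RelBilin I' I s x' g' g := by
  refine h.eventually_inv (hg.mono fun y hy hl v w => ?_)
  have aux : ∀ (a b : M) (v w : E), a = b → g a v w = g b v w := by rintro a _ v w rfl; rfl
  have h1 := hy (mfderiv I' I s (q y) v : E) (mfderiv I' I s (q y) w : E)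
  have h2 : ∀ v : E', (mfderiv I I' q y (mfderiv I' I s (q y) v : E) : E') = v :=
    hl.mfderiv_mfderiv'
  have h3 := congrArg₂ (fun v w : E' => g' (q y) v w) (h2 v) (h2 w)
  exact h3.symm.trans (h1.symm.trans (aux _ _ _ _ hl.inv_eq.symm))

/-! ### Pull-backs along a local diffeomorphism -/

variable (I I') in
/-- The pull-back of a `1`-form. -/
def pullForm (q : M → M') (η : OneForm I' M') : OneForm I M :=
  fun x => η (q x) ∘L mfderiv I I' q x

variable (I I') in
/-- The pull-back of an endomorphism field, where the differential of `q` is invertible. -/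
def pullEnd (q : M → M') (φ : EndField I' M') : EndField I M :=
  fun x => (mfderiv I I' q x).inverse ∘L φ (q x) ∘L mfderiv I I' q x

variable (I I') in
/-- The pull-back of a field of bilinear forms. -/
def pullBilin (q : M → M') (g : BilinField I' M') : BilinField I M :=
  fun x => ContinuousLinearMap.precomp ℝ (mfderiv I I' q x) ∘L g (q x) ∘L mfderiv I I' q x

lemma mfderiv_mpullback (h : IsLocalDiffeomorphAt I I' ∞ q x) (X' : VField I' M') :
    mfderiv I I' q x (mpullback I I' q X' x) = X' (q x) :=
  h.isInvertible_mfderiv.self_apply_inverse _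

lemma relField_mpullback (h : IsLocalDiffeomorphAt I I' ∞ q x) (X' : VField I' M') :
    RelField I I' q x (mpullback I I' q X') X' :=
  (eventually_isLocalDiffeomorphAt h).mono fun _ hy => mfderiv_mpullback hy X'

lemma RelField.eventuallyEq {X : VField I M} {X' : VField I' M'}
    (hX : RelField I I' q x X X') (h : IsLocalDiffeomorphAt I I' ∞ q x) :
    X =ᶠ[𝓝 x] mpullback I I' q X' := by
  filter_upwards [hX, eventually_isLocalDiffeomorphAt h] with y h1 h2
  rw [mpullback_apply, ← h1]
  exact (h2.isInvertible_mfderiv.inverse_apply_self _).symm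

lemma relForm_pullForm (η : OneForm I' M') : RelForm I I' q x (pullForm I I' q η) η :=
  Filter.Eventually.of_forall fun _ _ => rfl

lemma relEnd_pullEnd (h : IsLocalDiffeomorphAt I I' ∞ q x) (φ : EndField I' M') :
    RelEnd I I' q x (pullEnd I I' q φ) φ :=
  (eventually_isLocalDiffeomorphAt h).mono fun _ hy _ =>
    hy.isInvertible_mfderiv.self_apply_inverse _

lemma relBilin_pullBilin (g : BilinField I' M') : RelBilin I I' q x (pullBilin I I' q g) g :=
  Filter.Eventually.of_forall fun _ _ _ => rfl

end Related

section Transfer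

variable {E : Type*} [NormedAddCommGroup E] [NormedSpace ℝ E]
  {H : Type*} [TopologicalSpace H] {I : ModelWithCorners ℝ E H}
  {M : Type*} [TopologicalSpace M] [ChartedSpace H M] [IsManifold I ∞ M]
  {E' : Type*} [NormedAddCommGroup E'] [NormedSpace ℝ E']
  {H' : Type*} [TopologicalSpace H'] {I' : ModelWithCorners ℝ E' H'}
  {M' : Type*} [TopologicalSpace M'] [ChartedSpace H' M'] [IsManifold I' ∞ M']
  {q : M → M'} {x : M}

/-! ### Invariance of smoothness -/

lemma smoothFieldAt_mpullback [CompleteSpace E] (h : IsLocalDiffeomorphAt I I' ∞ q x)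
    {X' : VField I' M'} (hX' : SmoothFieldAt X' (q x)) :
    SmoothFieldAt (mpullback I I' q X') x :=
  ContMDiffAt.mpullback_vectorField_preimage hX' h.contMDiffAt h.isInvertible_mfderiv le_rfl

omit [IsManifold I ∞ M] in
lemma smoothOn_mpullback [CompleteSpace E] [IsManifold I ∞ M] {U : Set M}
    (h : ∀ x ∈ U, IsLocalDiffeomorphAt I I' ∞ q x)
    {X' : VField I' M'} (hX' : ∀ x ∈ U, SmoothFieldAt X' (q x)) :
    SmoothOn (mpullback I I' q X') U :=
  fun x hx => (smoothFieldAt_mpullback (h x hx) (hX' x hx)).contMDiffWithinAt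

lemma RelField.smoothFieldAt [CompleteSpace E] (h : IsLocalDiffeomorphAt I I' ∞ q x)
    {X : VField I M} {X' : VField I' M'} (hX : RelField I I' q x X X')
    (hX' : SmoothFieldAt X' (q x)) : SmoothFieldAt X x := by
  refine (smoothFieldAt_mpullback h hX').congr_of_eventuallyEq ?_
  filter_upwards [hX.eventuallyEq h] with y hy
  rw [hy]

/-- A vector field which is smooth at `x` is related to a vector field which is smooth at
`q x`. -/
lemma exists_relField [CompleteSpace E'] (h : IsLocalDiffeomorphAt I I' ∞ q x)
    {X : VField I M} (hX : SmoothFieldAt X x) :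
    ∃ X', RelField I I' q x X X' ∧ SmoothFieldAt X' (q x) := by
  obtain ⟨s, hs⟩ := exists_localInverse h
  refine ⟨mpullback I' I s X, (relField_mpullback hs.diffeo_inv X).symm hs.symm, ?_⟩
  exact smoothFieldAt_mpullback hs.diffeo_inv (hs.inv_eq.symm ▸ hX)

omit [IsManifold I ∞ M] [IsManifold I' ∞ M'] in
lemma RelField.app {φ : EndField I M} {φ' : EndField I' M'} {X : VField I M} {X' : VField I' M'}
    (hφ : RelEnd I I' q x φ φ') (hX : RelField I I' q x X X') :
    RelField I I' q x (app φ X) (QuasiVaisman.app φ' X') := by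
  filter_upwards [hφ, hX] with y h1 h2
  change mfderiv I I' q y (φ y (X y)) = φ' (q y) (X' (q y))
  rw [h1, h2]

omit [IsManifold I ∞ M] [IsManifold I' ∞ M'] in
lemma RelForm.apply {η : OneForm I M} {η' : OneForm I' M'} {X : VField I M} {X' : VField I' M'}
    (hη : RelForm I I' q x η η') (hX : RelField I I' q x X X') :
    (fun y => η y (X y)) =ᶠ[𝓝 x] (fun y => η' y (X' y)) ∘ q := by
  filter_upwards [hη, hX] with y h1 h2
  rw [h1, h2]
  rfl

omit [IsManifold I ∞ M] [IsManifold I' ∞ M'] in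
lemma RelBilin.apply {g : BilinField I M} {g' : BilinField I' M'} {X Y : VField I M}
    {X' Y' : VField I' M'} (hg : RelBilin I I' q x g g') (hX : RelField I I' q x X X')
    (hY : RelField I I' q x Y Y') :
    (fun y => g y (X y) (Y y)) =ᶠ[𝓝 x] (fun y => g' y (X' y) (Y' y)) ∘ q := by
  filter_upwards [hg, hX, hY] with y h1 h2 h3
  rw [h1, h2, h3]
  rfl

section Finite

variable [FiniteDimensional ℝ E] [CompleteSpace E']

lemma RelForm.smoothOneFormAt (h : IsLocalDiffeomorphAt I I' ∞ q x)
    {η : OneForm I M} {η' : OneForm I' M'} (hη : RelForm I I' q x η η')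
    (hη' : SmoothOneFormAt η' (q x)) : SmoothOneFormAt η x :=
  smoothOneFormAt_of_apply fun X hX => by
    obtain ⟨X', hr, hX'⟩ := exists_relField h hX
    exact ((hη'.apply hX').comp x h.contMDiffAt).congr_of_eventuallyEq (hη.apply hr)

lemma RelEnd.smoothEndAt (h : IsLocalDiffeomorphAt I I' ∞ q x)
    {φ : EndField I M} {φ' : EndField I' M'} (hφ : RelEnd I I' q x φ φ')
    (hφ' : SmoothEndAt φ' (q x)) : SmoothEndAt φ x :=
  smoothEndAt_of_apply fun X hX => by
    have := FiniteDimensional.complete ℝ E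
    obtain ⟨X', hr, hX'⟩ := exists_relField h hX
    exact (RelField.app hφ hr).smoothFieldAt h (hφ'.apply hX')

lemma RelBilin.smoothBilinAt (h : IsLocalDiffeomorphAt I I' ∞ q x)
    {g : BilinField I M} {g' : BilinField I' M'} (hg : RelBilin I I' q x g g')
    (hg' : SmoothBilinAt g' (q x)) : SmoothBilinAt g x :=
  smoothBilinAt_of_apply fun X Y hX hY => by
    obtain ⟨X', hr, hX'⟩ := exists_relField h hX
    obtain ⟨Y', hr', hY'⟩ := exists_relField h hY
    exact ((hg'.apply hX' hY').comp x h.contMDiffAt).congr_of_eventuallyEq (hg.apply hr hr')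

end Finite

/-! ### Naturality of the differential operators -/

omit [IsManifold I ∞ M] [IsManifold I' ∞ M'] in
lemma dirDeriv_eq_of_related (h : IsLocalDiffeomorphAt I I' ∞ q x) {X : VField I M}
    {X' : VField I' M'} (hX : RelField I I' q x X X') {u : M → ℝ} {u' : M' → ℝ}
    (hu : u =ᶠ[𝓝 x] u' ∘ q) (hu' : ContMDiffAt I' 𝓘(ℝ, ℝ) ∞ u' (q x)) :
    dirDeriv X u x = dirDeriv X' u' (q x) := by
  have h1 : mfderiv I 𝓘(ℝ, ℝ) u x = mfderiv I 𝓘(ℝ, ℝ) (u' ∘ q) x := hu.mfderiv_eq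
  have h2 : mfderiv I 𝓘(ℝ, ℝ) (u' ∘ q) x = (mfderiv I' 𝓘(ℝ, ℝ) u' (q x)).comp (mfderiv I I' q x) :=
    mfderiv_comp x (hu'.mdifferentiableAt (by simp)) (h.mdifferentiableAt (by simp))
  have h3 := congrArg (fun L : E →L[ℝ] ℝ => L (X x)) (h1.trans h2)
  refine h3.trans ?_
  exact congrArg (fun w : E' => (mfderiv I' 𝓘(ℝ, ℝ) u' (q x) w : ℝ)) hX.self_of_nhds

lemma mfderiv_mlieBracket [CompleteSpace E] (h : IsLocalDiffeomorphAt I I' ∞ q x)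
    {X Y : VField I M} {X' Y' : VField I' M'}
    (hX : RelField I I' q x X X') (hY : RelField I I' q x Y Y')
    (hX' : SmoothFieldAt X' (q x)) (hY' : SmoothFieldAt Y' (q x)) :
    mfderiv I I' q x (mlieBracket I X Y x) = mlieBracket I' X' Y' (q x) := by
  have : IsManifold I (minSmoothness ℝ 2) M := by
    simpa using (inferInstance : IsManifold I 2 M)
  have : IsManifold I' (minSmoothness ℝ 2) M' := by
    simpa using (inferInstance : IsManifold I' 2 M')
  rw [(hX.eventuallyEq h).mlieBracket_vectorField_eq (hY.eventuallyEq h),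
    ← mpullback_mlieBracket (n := ∞) (hX'.mdifferentiableAt (by simp))
      (hY'.mdifferentiableAt (by simp)) h.contMDiffAt (by simpa using ENat.LEInfty.out)]
  exact mfderiv_mpullback h _

section Operators

variable [CompleteSpace E] {X Y Z : VField I M} {X' Y' Z' : VField I' M'}
  (h : IsLocalDiffeomorphAt I I' ∞ q x)
  (hX : RelField I I' q x X X') (hY : RelField I I' q x Y Y') (hZ : RelField I I' q x Z Z')
  (hX' : SmoothFieldAt X' (q x)) (hY' : SmoothFieldAt Y' (q x)) (hZ' : SmoothFieldAt Z' (q x))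

include h hX hY hX' hY'

lemma dOne_eq_of_related {η : OneForm I M} {η' : OneForm I' M'} (hη : RelForm I I' q x η η')
    (hη' : SmoothOneFormAt η' (q x)) : dOne η X Y x = dOne η' X' Y' (q x) := by
  unfold dOne
  rw [dirDeriv_eq_of_related h hX (hη.apply hY) (hη'.apply hY'),
    dirDeriv_eq_of_related h hY (hη.apply hX) (hη'.apply hX'),
    ← mfderiv_mlieBracket h hX hY hX' hY', hη.self_of_nhds]

lemma nijenhuis_eq_of_related {φ : EndField I M} {φ' : EndField I' M'}
    (hφ : RelEnd I I' q x φ φ') (hφ' : SmoothEndAt φ' (q x)) :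
    mfderiv I I' q x (nijenhuis φ X Y x) = nijenhuis φ' X' Y' (q x) := by
  unfold nijenhuis
  rw [map_sub, map_add, hφ.self_of_nhds, hφ.self_of_nhds, hφ.self_of_nhds, map_add,
    mfderiv_mlieBracket h hX hY hX' hY',
    mfderiv_mlieBracket h (hX.app hφ) (hY.app hφ) (hφ'.apply hX') (hφ'.apply hY'),
    mfderiv_mlieBracket h (hX.app hφ) hY (hφ'.apply hX') hY',
    mfderiv_mlieBracket h hX (hY.app hφ) hX' (hφ'.apply hY')]

lemma lieDerivBilin_eq_of_related (hZ : RelField I I' q x Z Z') (hZ' : SmoothFieldAt Z' (q x))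
    {g : BilinField I M} {g' : BilinField I' M'}
    (hg : RelBilin I I' q x g g') (hg' : SmoothBilinAt g' (q x)) :
    lieDerivBilin Z g X Y x = lieDerivBilin Z' g' X' Y' (q x) := by
  unfold lieDerivBilin
  rw [dirDeriv_eq_of_related h hZ (hg.apply hX hY) (hg'.apply hX' hY'),
    ← mfderiv_mlieBracket h hZ hX hZ' hX', ← mfderiv_mlieBracket h hZ hY hZ' hY',
    hg.self_of_nhds, hg.self_of_nhds, hX.self_of_nhds, hY.self_of_nhds]

lemma lieDerivEnd_eq_of_related {φ : EndField I M} {φ' : EndField I' M'}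
    (hφ : RelEnd I I' q x φ φ') (hφ' : SmoothEndAt φ' (q x)) :
    mfderiv I I' q x (lieDerivEnd X φ Y x) = lieDerivEnd X' φ' Y' (q x) := by
  unfold lieDerivEnd
  rw [map_sub, hφ.self_of_nhds, mfderiv_mlieBracket h hX hY hX' hY',
    mfderiv_mlieBracket h hX (hY.app hφ) hX' (hφ'.apply hY')]

lemma dTwo_fundForm_eq_of_related (hZ : RelField I I' q x Z Z') (hZ' : SmoothFieldAt Z' (q x))
    {φ : EndField I M} {φ' : EndField I' M'} {g : BilinField I M} {g' : BilinField I' M'}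
    (hφ : RelEnd I I' q x φ φ') (hφ' : SmoothEndAt φ' (q x))
    (hg : RelBilin I I' q x g g') (hg' : SmoothBilinAt g' (q x)) :
    dTwo (fundForm φ g) X Y Z x = dTwo (fundForm φ' g') X' Y' Z' (q x) := by
  have aux : ∀ {A B C : VField I M} {A' B' C' : VField I' M'}, RelField I I' q x A A' →
      RelField I I' q x B B' → RelField I I' q x C C' → SmoothFieldAt B' (q x) →
      SmoothFieldAt C' (q x) → dirDeriv A (fun y => g y (B y) (φ y (C y))) x =
        dirDeriv A' (fun y => g' y (B' y) (φ' y (C' y))) (q x) := fun hA hB hC hB' hC' =>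
    dirDeriv_eq_of_related h hA (hg.apply hB (hC.app hφ)) (hg'.apply hB' (hφ'.apply hC'))
  unfold dTwo fundForm
  rw [aux hX hY hZ hY' hZ', aux hY hZ hX hZ' hX', aux hZ hX hY hX' hY',
    hg.self_of_nhds, hg.self_of_nhds, hg.self_of_nhds,
    hφ.self_of_nhds, hφ.self_of_nhds, hφ.self_of_nhds,
    mfderiv_mlieBracket h hX hY hX' hY', mfderiv_mlieBracket h hY hZ hY' hZ',
    mfderiv_mlieBracket h hZ hX hZ' hX', hX.self_of_nhds, hY.self_of_nhds, hZ.self_of_nhds]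

end Operators

end Transfer

/-! ### Tensor fields and differential operators on a vector space -/

section VectorSpace

variable {E : Type*} [NormedAddCommGroup E] [NormedSpace ℝ E]

lemma smoothFieldAt_iff_contDiffAt {X : E → E} {z : E} :
    SmoothFieldAt (I := 𝓘(ℝ, E)) (M := E) X z ↔ ContDiffAt ℝ ∞ X z :=
  contMDiffAt_vectorSpace_iff_contDiffAt

section Smooth

variable [FiniteDimensional ℝ E]

lemma smoothOneFormAt_iff_contDiffAt {η : E → E →L[ℝ] ℝ} {z : E} :
    SmoothOneFormAt (I := 𝓘(ℝ, E)) (M := E) η z ↔ ContDiffAt ℝ ∞ η z := by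
  refine ⟨fun h => ?_, fun h => smoothOneFormAt_of_apply fun X hX => ?_⟩
  · refine ContMDiffAt.contDiffAt (contMDiffAt_clm_of_apply fun v => ?_)
    exact h.apply (X := fun _ => v) (smoothFieldAt_iff_contDiffAt.2 contDiffAt_const)
  · exact (ContDiffAt.clm_apply h (smoothFieldAt_iff_contDiffAt.1 hX)).contMDiffAt

lemma smoothEndAt_iff_contDiffAt {φ : E → E →L[ℝ] E} {z : E} :
    SmoothEndAt (I := 𝓘(ℝ, E)) (M := E) φ z ↔ ContDiffAt ℝ ∞ φ z := by
  refine ⟨fun h => ?_, fun h => smoothEndAt_of_apply fun X hX => ?_⟩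
  · refine ContMDiffAt.contDiffAt (contMDiffAt_clm_of_apply fun v => ?_)
    exact (smoothFieldAt_iff_contDiffAt.1 <| h.apply (X := fun _ => v)
      (smoothFieldAt_iff_contDiffAt.2 contDiffAt_const)).contMDiffAt
  · exact smoothFieldAt_iff_contDiffAt.2
      (ContDiffAt.clm_apply h (smoothFieldAt_iff_contDiffAt.1 hX))

lemma smoothBilinAt_iff_contDiffAt {g : E → E →L[ℝ] E →L[ℝ] ℝ} {z : E} :
    SmoothBilinAt (I := 𝓘(ℝ, E)) (M := E) g z ↔ ContDiffAt ℝ ∞ g z := by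
  refine ⟨fun h => ?_, fun h => smoothBilinAt_of_apply fun X Y hX hY => ?_⟩
  · refine ContMDiffAt.contDiffAt (contMDiffAt_clm_of_apply fun v =>
      contMDiffAt_clm_of_apply fun w => ?_)
    exact h.apply (X := fun _ => v) (Y := fun _ => w)
      (smoothFieldAt_iff_contDiffAt.2 contDiffAt_const)
      (smoothFieldAt_iff_contDiffAt.2 contDiffAt_const)
  · exact ((ContDiffAt.clm_apply h (smoothFieldAt_iff_contDiffAt.1 hX)).clm_apply
      (smoothFieldAt_iff_contDiffAt.1 hY)).contMDiffAt

end Smooth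

lemma mlieBracket_vectorSpace (X Y : E → E) (z : E) :
    (mlieBracket 𝓘(ℝ, E) X Y z : E) = fderiv ℝ Y z (X z) - fderiv ℝ X z (Y z) := by
  have h : mlieBracketWithin 𝓘(ℝ, E) X Y Set.univ z = lieBracketWithin ℝ X Y Set.univ z :=
    congrFun mlieBracketWithin_eq_lieBracketWithin z
  rw [lieBracketWithin_univ, lieBracket_eq] at h
  exact h

lemma dirDeriv_vectorSpace (X : E → E) (u : E → ℝ) (z : E) :
    dirDeriv (I := 𝓘(ℝ, E)) (M := E) X u z = fderiv ℝ u z (X z) := by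
  unfold dirDeriv
  rw [mfderiv_eq_fderiv]
  rfl

lemma fderiv_clm_field {F : Type*} [NormedAddCommGroup F] [NormedSpace ℝ F]
    {φ : E → E →L[ℝ] F} {X : E → E} {z : E} (hφ : DifferentiableAt ℝ φ z)
    (hX : DifferentiableAt ℝ X z) (v : E) :
    fderiv ℝ (fun y => φ y (X y)) z v = fderiv ℝ φ z v (X z) + φ z (fderiv ℝ X z v) := by
  rw [fderiv_clm_apply hφ hX]
  simp [add_comm]

variable {X Y Z : E → E} {z : E}

/-- The coordinate expression of the exterior derivative of a `1`-form. -/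
lemma dOne_vectorSpace {η : E → E →L[ℝ] ℝ} (hη : DifferentiableAt ℝ η z)
    (hX : DifferentiableAt ℝ X z) (hY : DifferentiableAt ℝ Y z) :
    dOne (I := 𝓘(ℝ, E)) (M := E) η X Y z
      = fderiv ℝ η z (X z) (Y z) - fderiv ℝ η z (Y z) (X z) := by
  have h1 := mlieBracket_vectorSpace X Y z
  have h2 := dirDeriv_vectorSpace X (fun x => η x (Y x)) z
  have h3 := dirDeriv_vectorSpace Y (fun x => η x (X x)) z
  rw [fderiv_clm_field hη hY] at h2
  rw [fderiv_clm_field hη hX] at h3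
  have h4 : η z (mlieBracket 𝓘(ℝ, E) X Y z) = _ := congrArg (η z) h1
  rw [map_sub] at h4
  unfold dOne
  refine (congrArg₂ (· - ·) (congrArg₂ (· - ·) h2 h3) h4).trans ?_
  ring

/-- The coordinate expression of the Nijenhuis torsion. -/
lemma nijenhuis_vectorSpace {φ : E → E →L[ℝ] E} (hφ : DifferentiableAt ℝ φ z)
    (hX : DifferentiableAt ℝ X z) (hY : DifferentiableAt ℝ Y z) :
    (nijenhuis (I := 𝓘(ℝ, E)) (M := E) φ X Y z : E)
      = fderiv ℝ φ z (φ z (X z)) (Y z) - fderiv ℝ φ z (φ z (Y z)) (X z)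
        - φ z (fderiv ℝ φ z (X z) (Y z)) + φ z (fderiv ℝ φ z (Y z) (X z)) := by
  have h1 := mlieBracket_vectorSpace X Y z
  have h2 := mlieBracket_vectorSpace (fun y => φ y (X y)) (fun y => φ y (Y y)) z
  have h3 := mlieBracket_vectorSpace (fun y => φ y (X y)) Y z
  have h4 := mlieBracket_vectorSpace X (fun y => φ y (Y y)) z
  rw [fderiv_clm_field hφ hY, fderiv_clm_field hφ hX] at h2
  rw [fderiv_clm_field hφ hX] at h3
  rw [fderiv_clm_field hφ hY] at h4
  have aux : ∀ {b₁ b₂ b₃ b₄ c₁ c₂ c₃ c₄ : E}, b₁ = c₁ → b₂ = c₂ → b₃ = c₃ → b₄ = c₄ →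
      φ z (φ z b₁) + b₂ - φ z (b₃ + b₄) = φ z (φ z c₁) + c₂ - φ z (c₃ + c₄) := by
    rintro _ _ _ _ _ _ _ _ rfl rfl rfl rfl
    rfl
  refine (aux h1 h2 h3 h4).trans ?_
  simp only [map_sub, map_add]
  abel

/-- The coordinate expression of the Lie derivative of an endomorphism field. -/
lemma lieDerivEnd_vectorSpace {φ : E → E →L[ℝ] E} (hφ : DifferentiableAt ℝ φ z)
    (hY : DifferentiableAt ℝ Y z) :
    (lieDerivEnd (I := 𝓘(ℝ, E)) (M := E) X φ Y z : E)
      = fderiv ℝ φ z (X z) (Y z) - fderiv ℝ X z (φ z (Y z)) + φ z (fderiv ℝ X z (Y z)) := by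
  have h1 := mlieBracket_vectorSpace X Y z
  have h2 := mlieBracket_vectorSpace X (fun y => φ y (Y y)) z
  rw [fderiv_clm_field hφ hY] at h2
  have aux : ∀ {b₁ b₂ c₁ c₂ : E}, b₁ = c₁ → b₂ = c₂ → b₂ - φ z b₁ = c₂ - φ z c₁ := by
    rintro _ _ _ _ rfl rfl
    rfl
  refine (aux h1 h2).trans ?_
  simp only [map_sub]
  abel

lemma fderiv_bilin_field {g : E → E →L[ℝ] E →L[ℝ] ℝ} (hg : DifferentiableAt ℝ g z)
    (hX : DifferentiableAt ℝ X z) (hY : DifferentiableAt ℝ Y z) (v : E) :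
    fderiv ℝ (fun y => g y (X y) (Y y)) z v = fderiv ℝ g z v (X z) (Y z)
      + g z (fderiv ℝ X z v) (Y z) + g z (X z) (fderiv ℝ Y z v) := by
  rw [fderiv_clm_field (φ := fun y => g y (X y)) (hg.clm_apply hX) hY, fderiv_clm_field hg hX]
  simp

/-- The coordinate expression of the Lie derivative of a field of bilinear forms. -/
lemma lieDerivBilin_vectorSpace {g : E → E →L[ℝ] E →L[ℝ] ℝ} (hg : DifferentiableAt ℝ g z)
    (hY : DifferentiableAt ℝ Y z) (hZ : DifferentiableAt ℝ Z z) :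
    lieDerivBilin (I := 𝓘(ℝ, E)) (M := E) X g Y Z z
      = fderiv ℝ g z (X z) (Y z) (Z z) + g z (fderiv ℝ X z (Y z)) (Z z)
        + g z (Y z) (fderiv ℝ X z (Z z)) := by
  have h1 := mlieBracket_vectorSpace X Y z
  have h2 := mlieBracket_vectorSpace X Z z
  have h3 := dirDeriv_vectorSpace X (fun x => g x (Y x) (Z x)) z
  rw [fderiv_bilin_field hg hY hZ] at h3
  unfold lieDerivBilin
  refine (congrArg₂ (· - ·) (congrArg₂ (· - ·) h3 (congrArg (fun w : E => g z w (Z z)) h1))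
    (congrArg (fun w : E => g z (Y z) w) h2)).trans ?_
  simp only [map_sub, sub_apply]
  ring

/-- The coordinate expression of the exterior derivative of a `2`-form `w`, given near `z` by
a differentiable field `σ` of bilinear forms. -/
lemma dTwo_vectorSpace {w : E → E → E → ℝ} {σ : E → E →L[ℝ] E →L[ℝ] ℝ}
    (hw : ∀ᶠ y in 𝓝 z, ∀ u v, w y u v = σ y u v) (hanti : ∀ u v, σ z u v = - σ z v u)
    (hw' : DifferentiableAt ℝ σ z) (hX : DifferentiableAt ℝ X z) (hY : DifferentiableAt ℝ Y z)
    (hZ : DifferentiableAt ℝ Z z) :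
    dTwo (I := 𝓘(ℝ, E)) (M := E) w X Y Z z
      = fderiv ℝ σ z (X z) (Y z) (Z z) + fderiv ℝ σ z (Y z) (Z z) (X z)
        + fderiv ℝ σ z (Z z) (X z) (Y z) := by
  have aux : ∀ {A B C : E → E}, DifferentiableAt ℝ B z → DifferentiableAt ℝ C z →
      dirDeriv (I := 𝓘(ℝ, E)) (M := E) A (fun y => w y (B y) (C y)) z
        = fderiv ℝ σ z (A z) (B z) (C z) + σ z (fderiv ℝ B z (A z)) (C z)
          + σ z (B z) (fderiv ℝ C z (A z)) := by
    intro A B C hB hC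
    rw [dirDeriv_vectorSpace, ← fderiv_bilin_field hw' hB hC]
    congr 1
    exact Filter.EventuallyEq.fderiv_eq (hw.mono fun y hy => hy _ _)
  have br : ∀ A B C : E → E, w z (mlieBracket 𝓘(ℝ, E) A B z) (C z)
      = σ z (fderiv ℝ B z (A z)) (C z) - σ z (fderiv ℝ A z (B z)) (C z) := by
    intro A B C
    refine (hw.self_of_nhds _ _).trans ?_
    refine (congrArg (fun u : E => σ z u (C z)) (mlieBracket_vectorSpace A B z)).trans ?_
    simp only [map_sub, sub_apply]
  unfold dTwo
  refine (congrArg₂ (· - ·) (congrArg₂ (· - ·) (congrArg₂ (· - ·) (congrArg₂ (· + ·)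
    (congrArg₂ (· + ·) (aux hY hZ) (aux hZ hX)) (aux hX hY)) (br X Y Z)) (br Y Z X))
    (br Z X Y)).trans ?_
  rw [hanti (Y z) (fderiv ℝ Z z (X z)), hanti (Z z) (fderiv ℝ X z (Y z)),
    hanti (X z) (fderiv ℝ Y z (Z z))]
  ring

end VectorSpace

/-! ### Linear algebra of almost contact metric structures -/

section Algebra

variable {V : Type*} [NormedAddCommGroup V] [NormedSpace ℝ V]

/-- The algebraic conditions on an almost contact metric structure, in one tangent space. -/
structure AlmostContactSpace (φ : V →L[ℝ] V) (ξ : V) (η : V →L[ℝ] ℝ) (h : V →L[ℝ] V →L[ℝ] ℝ) :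
    Prop where
  phi_sq : ∀ v, φ (φ v) = -v + η v • ξ
  eta_xi : η ξ = 1
  compat : ∀ v w, h (φ v) (φ w) = h v w - η v * η w
  symm : ∀ v w, h v w = h w v

/-- The endomorphism `J = φ - ∂/∂t ⊗ η + ξ ⊗ dt` of `V × ℝ`. -/
def spaceJ (φ : V →L[ℝ] V) (ξ : V) (η : V →L[ℝ] ℝ) : V × ℝ →L[ℝ] V × ℝ :=
  ((φ ∘L ContinuousLinearMap.fst ℝ V ℝ) + (ContinuousLinearMap.snd ℝ V ℝ).smulRight ξ).prod
    (-(η ∘L ContinuousLinearMap.fst ℝ V ℝ))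

/-- The bilinear form `g = h + dt ⊗ dt` on `V × ℝ`. -/
def spaceMetric (h : V →L[ℝ] V →L[ℝ] ℝ) : V × ℝ →L[ℝ] V × ℝ →L[ℝ] ℝ :=
  ContinuousLinearMap.precomp ℝ (ContinuousLinearMap.fst ℝ V ℝ) ∘L h ∘L
    ContinuousLinearMap.fst ℝ V ℝ
    + (ContinuousLinearMap.snd ℝ V ℝ).smulRight (ContinuousLinearMap.snd ℝ V ℝ)

variable {φ : V →L[ℝ] V} {ξ : V} {η : V →L[ℝ] ℝ} {h : V →L[ℝ] V →L[ℝ] ℝ}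

lemma spaceJ_apply (v : V × ℝ) : spaceJ φ ξ η v = (φ v.1 + v.2 • ξ, -η v.1) := rfl

lemma spaceMetric_apply (v w : V × ℝ) : spaceMetric h v w = h v.1 w.1 + v.2 * w.2 := rfl

namespace AlmostContactSpace

variable (hs : AlmostContactSpace φ ξ η h)
include hs

lemma smul_xi {c : ℝ} (hc : c • ξ = 0) : c = 0 := by
  simpa [hs.eta_xi] using congrArg η hc

lemma phi_xi : φ ξ = 0 := by
  have h1 : φ (φ ξ) = 0 := by rw [hs.phi_sq, hs.eta_xi]; simp
  have h2 := hs.phi_sq (φ ξ)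
  rw [h1, map_zero] at h2
  have h3 : φ ξ = η (φ ξ) • ξ := by rw [← add_left_inj (-φ ξ)]; simpa [add_comm] using h2
  have h4 : (η (φ ξ) * η (φ ξ)) • ξ = 0 := by
    rw [mul_smul, ← h3, ← map_smul, ← h3, h1]
  rw [h3, mul_self_eq_zero.1 (hs.smul_xi h4), zero_smul]

lemma eta_phi (v : V) : η (φ v) = 0 := by
  have h1 := hs.phi_sq (φ v)
  rw [hs.phi_sq v, map_add, map_smul, hs.phi_xi] at h1
  exact hs.smul_xi (by simpa using h1)

lemma metric_xi (v : V) : h v ξ = η v := by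
  have := hs.compat v ξ
  rw [hs.phi_xi, hs.eta_xi, map_zero] at this
  linarith

lemma fund_anti (v w : V) : h v (φ w) = -h w (φ v) := by
  have h1 := hs.compat v (φ w)
  rw [hs.phi_sq, hs.eta_phi] at h1
  simp only [map_add, map_neg, map_smul, hs.metric_xi, hs.eta_phi, smul_eq_mul] at h1
  rw [hs.symm w]
  linarith

lemma spaceJ_sq (v : V × ℝ) : spaceJ φ ξ η (spaceJ φ ξ η v) = -v := by
  simp only [spaceJ_apply]
  ext
  · simp [hs.phi_sq, hs.phi_xi]
  · simp [hs.eta_phi, hs.eta_xi]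

lemma spaceMetric_compat (v w : V × ℝ) :
    spaceMetric h (spaceJ φ ξ η v) (spaceJ φ ξ η w) = spaceMetric h v w := by
  simp only [spaceMetric_apply, spaceJ_apply, map_add, map_smul, add_apply,
    smul_apply, hs.metric_xi, hs.compat, hs.eta_phi, smul_eq_mul,
    hs.symm ξ, hs.eta_xi]
  ring

/-- The value of `Ω = Φ + η ∧ dt`. -/
lemma spaceFund (v w : V × ℝ) : spaceMetric h v (spaceJ φ ξ η w)
    = h v.1 (φ w.1) + w.2 * η v.1 - v.2 * η w.1 := by
  simp only [spaceMetric_apply, spaceJ_apply, map_add, map_smul, hs.metric_xi, smul_eq_mul]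
  ring

end AlmostContactSpace

/-- The `1`-jet at a point of an almost contact metric structure which is normal there: the primed
maps stand for the derivatives of the tensor fields, and the last three equations before `normal`
are the derivatives of `η ∘ φ = 0`, `η(ξ) = 1` and `φ ξ = 0`. -/
structure NormalJet (φ : V →L[ℝ] V) (ξ : V) (η : V →L[ℝ] ℝ) (h : V →L[ℝ] V →L[ℝ] ℝ)
    (φ' : V →L[ℝ] V →L[ℝ] V) (ξ' : V →L[ℝ] V) (η' : V →L[ℝ] V →L[ℝ] ℝ) : Prop
    extends AlmostContactSpace φ ξ η h where
  d_eta_phi : ∀ w v, η' w (φ v) = -η (φ' w v)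
  d_eta_xi : ∀ w, η' w ξ = -η (ξ' w)
  d_phi_xi : ∀ w, φ' w ξ = -φ (ξ' w)
  normal : ∀ v w, φ' (φ v) w - φ' (φ w) v - φ (φ' v w) + φ (φ' w v)
    + (η' v w - η' w v) • ξ = 0

namespace NormalJet

variable {φ' : V →L[ℝ] V →L[ℝ] V} {ξ' : V →L[ℝ] V} {η' : V →L[ℝ] V →L[ℝ] ℝ}
  (hj : NormalJet φ ξ η h φ' ξ' η')
include hj

/-- `dη(φ v, φ w) = dη(v, w)`: the `ξ`-component of normality. -/
lemma deta_phi_phi (v w : V) :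
    η' (φ v) (φ w) - η' (φ w) (φ v) = η' v w - η' w v := by
  have h1 := congrArg η (hj.normal v w)
  simp only [map_add, map_sub, map_smul, hj.eta_phi, hj.eta_xi, map_zero, smul_eq_mul] at h1
  rw [hj.d_eta_phi, hj.d_eta_phi]
  linarith

/-- `dη(v, ξ) = 0`. -/
lemma deta_xi (v : V) : η' v ξ = η' ξ v := by
  have := hj.deta_phi_phi v ξ
  rw [hj.phi_xi] at this
  simp only [map_zero, zero_apply] at this
  linarith

/-- `dη(φ v, w) + dη(v, φ w) = 0`. -/
lemma deta_phi (v w : V) : η' (φ v) w - η' w (φ v) + (η' v (φ w) - η' (φ w) v) = 0 := by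
  have h1 := hj.deta_phi_phi v (φ w)
  have h2 := hj.deta_xi (φ v)
  rw [hj.phi_sq w] at h1
  simp only [map_add, map_neg, map_smul, add_apply,
    neg_apply, smul_apply, smul_eq_mul] at h1
  rw [h2] at h1
  linarith

/-- The Lie derivative of `φ` along `ξ` vanishes. -/
lemma lie_xi_phi (v : V) : φ' ξ v - ξ' (φ v) + φ (ξ' v) = 0 := by
  have h1 := hj.normal v ξ
  rw [hj.phi_xi, hj.deta_xi, hj.d_phi_xi, hj.d_phi_xi] at h1
  have h2 : φ (φ' ξ v - ξ' (φ v) + φ (ξ' v)) = 0 := by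
    simp only [map_add, map_sub, map_neg, map_zero, zero_apply] at h1 ⊢
    rw [← h1]
    simp only [sub_self, zero_smul]
    abel
  have h3 : η (φ' ξ v - ξ' (φ v) + φ (ξ' v)) = 0 := by
    have e1 := hj.d_eta_phi ξ v
    have e2 := hj.d_eta_xi (φ v)
    have e3 := hj.deta_xi (φ v)
    simp only [map_add, map_sub, hj.eta_phi]
    linarith
  have h4 := hj.phi_sq (φ' ξ v - ξ' (φ v) + φ (ξ' v))
  rw [h2, h3, map_zero, zero_smul, add_zero] at h4
  exact neg_eq_zero.1 h4.symm

/-- `J` is integrable. The horizontal component of its torsion reduces to the normality and to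
the vanishing of `L_ξ φ`, the vertical one to `dη(φ v, w) + dη(v, φ w) = 0` and `L_ξ η = 0`. -/
lemma nijenhuis_spaceJ (v w : V × ℝ) :
    let J := spaceJ φ ξ η
    let J' : V → V × ℝ →L[ℝ] V × ℝ := fun u => spaceJ (φ' u) (ξ' u) (η' u)
    J' (J v).1 w - J' (J w).1 v - J (J' v.1 w) + J (J' w.1 v) = 0 := by
  obtain ⟨v, a⟩ := v
  obtain ⟨w, b⟩ := w
  ext
  · simp only [spaceJ_apply, map_add, map_smul, add_apply,
      smul_apply, Prod.fst_sub, Prod.fst_add, Prod.fst_zero]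
    have h1 := hj.normal v w
    have h2 := congrArg (a • ·) (hj.lie_xi_phi w)
    have h3 := congrArg (b • ·) (hj.lie_xi_phi v)
    simp only [smul_add, smul_sub, smul_zero] at h2 h3
    calc _ = (φ' (φ v) w - φ' (φ w) v - φ (φ' v w) + φ (φ' w v) + (η' v w - η' w v) • ξ)
          + (a • φ' ξ w - a • ξ' (φ w) + a • φ (ξ' w))
          - (b • φ' ξ v - b • ξ' (φ v) + b • φ (ξ' v)) := by module
      _ = 0 := by rw [h1, h2, h3]; simp
  · simp only [spaceJ_apply, map_add, map_smul, add_apply,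
      smul_apply, Prod.snd_sub, Prod.snd_add, Prod.snd_zero, smul_eq_mul]
    have h1 := hj.deta_phi v w
    have h2 := hj.d_eta_phi v w
    have h3 := hj.d_eta_phi w v
    have h4 := hj.deta_xi v
    have h5 := hj.deta_xi w
    have h6 := hj.d_eta_xi v
    have h7 := hj.d_eta_xi w
    linear_combination -h1 + h2 - h3 - b * h4 + a * h5 + b * h6 - a * h7

end NormalJet

end Algebra

/-! ### Quasi-Sasakian structures in coordinates -/

section Coordinates

variable {E : Type*} [NormedAddCommGroup E] [NormedSpace ℝ E]
  {H : Type*} [TopologicalSpace H] {I : ModelWithCorners ℝ E H}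
  {M : Type*} [TopologicalSpace M] [ChartedSpace H M]

lemma isLocalDiffeomorphAt_extChartAt [I.Boundaryless] [IsManifold I ∞ M] (x : M) :
    IsLocalDiffeomorphAt I 𝓘(ℝ, E) ∞ (extChartAt I x) x :=
  ⟨{ toPartialEquiv := extChartAt I x
     open_source := isOpen_extChartAt_source x
     open_target := isOpen_extChartAt_target x
     contMDiffOn_toFun := by
      simpa only [extChartAt_source] using contMDiffOn_extChartAt (I := I) (n := ∞) (x := x)
     contMDiffOn_invFun := contMDiffOn_extChartAt_symm x },
    mem_extChartAt_source x, fun _ _ => rfl⟩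

lemma fderiv_clm_const {F G : Type*} [NormedAddCommGroup F] [NormedSpace ℝ F]
    [NormedAddCommGroup G] [NormedSpace ℝ G] {φ : E → F →L[ℝ] G} {z : E}
    (hφ : DifferentiableAt ℝ φ z) (w : E) (v : F) :
    fderiv ℝ φ z w v = fderiv ℝ (fun y => φ y v) z w := by
  rw [fderiv_clm_apply hφ (differentiableAt_const v)]
  simp

lemma contDiffAt_clm_of_apply {F G : Type*} [NormedAddCommGroup F] [NormedSpace ℝ F]
    [FiniteDimensional ℝ F] [NormedAddCommGroup G] [NormedSpace ℝ G] {φ : E → F →L[ℝ] G} {z : E}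
    (h : ∀ v, ContDiffAt ℝ ∞ (fun y => φ y v) z) : ContDiffAt ℝ ∞ φ z :=
  (contMDiffAt_clm_of_apply fun v => (h v).contMDiffAt).contDiffAt

/-- The coordinate expression of the exterior derivative of a fundamental form. -/
lemma dTwo_fundForm_vectorSpace [FiniteDimensional ℝ E] {φ : E → E →L[ℝ] E}
    {g : E → E →L[ℝ] E →L[ℝ] ℝ} {X Y Z : E → E} {z : E}
    (hφ : ContDiffAt ℝ ∞ φ z) (hg : ContDiffAt ℝ ∞ g z)
    (hanti : ∀ u v, g z u (φ z v) = -g z v (φ z u))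
    (hX : DifferentiableAt ℝ X z) (hY : DifferentiableAt ℝ Y z) (hZ : DifferentiableAt ℝ Z z) :
    dTwo (I := 𝓘(ℝ, E)) (M := E) (fundForm (I := 𝓘(ℝ, E)) (M := E) φ g) X Y Z z
      = fderiv ℝ (fun y => g y (Y z) (φ y (Z z))) z (X z)
        + fderiv ℝ (fun y => g y (Z z) (φ y (X z))) z (Y z)
        + fderiv ℝ (fun y => g y (X z) (φ y (Y z))) z (Z z) := by
  let σ : E → E →L[ℝ] E →L[ℝ] ℝ := fun y => ContinuousLinearMap.precomp ℝ (φ y) ∘L g y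
  have hσa : ∀ a b, ContDiffAt ℝ ∞ (fun y => σ y a b) z := fun a b =>
    (hg.clm_apply contDiffAt_const).clm_apply (hφ.clm_apply contDiffAt_const)
  have hσ₁ : ∀ a, ContDiffAt ℝ ∞ (fun y => σ y a) z := fun a => contDiffAt_clm_of_apply (hσa a)
  have hσ : DifferentiableAt ℝ σ z := (contDiffAt_clm_of_apply hσ₁).differentiableAt (by simp)
  have hσ' : ∀ a b c : E, fderiv ℝ σ z a b c = fderiv ℝ (fun y => σ y b c) z a := by
    intro a b c
    rw [fderiv_clm_const hσ, fderiv_clm_const ((hσ₁ b).differentiableAt (by simp))]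
  have e := dTwo_vectorSpace (w := fundForm (I := 𝓘(ℝ, E)) (M := E) φ g) (σ := σ)
    (Filter.Eventually.of_forall fun y a b => rfl) hanti hσ hX hY hZ
  rw [hσ', hσ', hσ'] at e
  exact e

variable {φ : EndField I M} {ξ : VField I M} {η : OneForm I M} {h : BilinField I M}

/-- A quasi-Sasakian structure, written in the coordinates `f` near `x`: the coordinate
expressions are smooth at `f x`, almost contact metric near `f x`, and satisfy at `f x` the
differential equations of normality and of closedness of the fundamental form. -/
structure CoordExpr (φ : EndField I M) (ξ : VField I M) (η : OneForm I M) (h : BilinField I M)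
    (f : M → E) (x : M) (φc : E → E →L[ℝ] E) (ξc : E → E) (ηc : E → E →L[ℝ] ℝ)
    (hc : E → E →L[ℝ] E →L[ℝ] ℝ) : Prop where
  diffeo : IsLocalDiffeomorphAt I 𝓘(ℝ, E) ∞ f x
  rel_phi : RelEnd I 𝓘(ℝ, E) f x φ φc
  rel_xi : RelField I 𝓘(ℝ, E) f x ξ ξc
  rel_eta : RelForm I 𝓘(ℝ, E) f x η ηc
  rel_metric : RelBilin I 𝓘(ℝ, E) f x h hc
  smooth_phi : ContDiffAt ℝ ∞ φc (f x)
  smooth_xi : ContDiffAt ℝ ∞ ξc (f x)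
  smooth_eta : ContDiffAt ℝ ∞ ηc (f x)
  smooth_metric : ContDiffAt ℝ ∞ hc (f x)
  space : ∀ᶠ z in 𝓝 (f x), AlmostContactSpace (φc z) (ξc z) (ηc z) (hc z)
  jet : NormalJet (φc (f x)) (ξc (f x)) (ηc (f x)) (hc (f x))
    (fderiv ℝ φc (f x)) (fderiv ℝ ξc (f x)) (fderiv ℝ ηc (f x))
  closed : ∀ u v w,
    fderiv ℝ (fun z => hc z v (φc z w)) (f x) u + fderiv ℝ (fun z => hc z w (φc z u)) (f x) v
      + fderiv ℝ (fun z => hc z u (φc z v)) (f x) w = 0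

variable [IsManifold I ∞ M]

lemma IsAlmostContactMetric.space (hs : IsAlmostContactMetric φ ξ η h) (x : M) :
    AlmostContactSpace (V := E) (φ x) (ξ x) (η x) (h x) where
  phi_sq := hs.phi_sq x
  eta_xi := hs.eta_xi x
  compat := hs.compat x
  symm v w := by
    obtain ⟨G, hG⟩ := hs.metric
    have := G.symm x v w
    rwa [hG] at this

/-- The equations on derivatives in `NormalJet` follow by differentiating the identities
`η ∘ φ = 0`, `η(ξ) = 1` and `φ ξ = 0`, which hold near the point. -/
lemma normalJet_of_eventually {φc : E → E →L[ℝ] E} {ξc : E → E} {ηc : E → E →L[ℝ] ℝ}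
    {hc : E → E →L[ℝ] E →L[ℝ] ℝ} {z : E}
    (hφ : ContDiffAt ℝ ∞ φc z) (hξ : ContDiffAt ℝ ∞ ξc z) (hη : ContDiffAt ℝ ∞ ηc z)
    (hs : ∀ᶠ y in 𝓝 z, AlmostContactSpace (φc y) (ξc y) (ηc y) (hc y))
    (hn : ∀ v w, fderiv ℝ φc z (φc z v) w - fderiv ℝ φc z (φc z w) v
      - φc z (fderiv ℝ φc z v w) + φc z (fderiv ℝ φc z w v)
      + (fderiv ℝ ηc z v w - fderiv ℝ ηc z w v) • ξc z = 0) :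
    NormalJet (φc z) (ξc z) (ηc z) (hc z) (fderiv ℝ φc z) (fderiv ℝ ξc z) (fderiv ℝ ηc z) where
  toAlmostContactSpace := hs.self_of_nhds
  d_eta_phi w v := by
    have hφ := hφ.differentiableAt (by simp)
    have hη := hη.differentiableAt (by simp)
    have h1 := fderiv_clm_field hη (hφ.clm_apply (differentiableAt_const v)) w
    have h2 : (fun y => ηc y (φc y v)) =ᶠ[𝓝 z] fun _ => 0 := hs.mono fun y hy => hy.eta_phi v
    rw [h2.fderiv_eq, ← fderiv_clm_const hφ] at h1
    simp only [fderiv_fun_const, Pi.zero_apply, zero_apply] at h1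
    linarith
  d_eta_xi w := by
    have h1 := fderiv_clm_field (hη.differentiableAt (by simp)) (hξ.differentiableAt (by simp)) w
    have h2 : (fun y => ηc y (ξc y)) =ᶠ[𝓝 z] fun _ => 1 := hs.mono fun y hy => hy.eta_xi
    rw [h2.fderiv_eq] at h1
    simp only [fderiv_fun_const, Pi.zero_apply, zero_apply] at h1
    linarith
  d_phi_xi w := by
    have h1 := fderiv_clm_field (hφ.differentiableAt (by simp)) (hξ.differentiableAt (by simp)) w
    have h2 : (fun y => φc y (ξc y)) =ᶠ[𝓝 z] fun _ => 0 := hs.mono fun y hy => hy.phi_xi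
    rw [h2.fderiv_eq] at h1
    simp only [fderiv_fun_const, Pi.zero_apply, zero_apply] at h1
    exact eq_neg_of_add_eq_zero_left h1.symm
  normal := hn

/-- A bijective linear map which intertwines two sets of tensors transports the almost contact
metric conditions. -/
lemma AlmostContactSpace.transport {V W : Type*} [NormedAddCommGroup V] [NormedSpace ℝ V]
    [NormedAddCommGroup W] [NormedSpace ℝ W] {φ : V →L[ℝ] V} {ξ : V} {η : V →L[ℝ] ℝ}
    {h : V →L[ℝ] V →L[ℝ] ℝ} {φ' : W →L[ℝ] W} {ξ' : W} {η' : W →L[ℝ] ℝ} {h' : W →L[ℝ] W →L[ℝ] ℝ}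
    (hs : AlmostContactSpace φ ξ η h) (A : V →L[ℝ] W) (hA : Function.Surjective A)
    (hφ : ∀ v, A (φ v) = φ' (A v)) (hξ : A ξ = ξ') (hη : ∀ v, η v = η' (A v))
    (hh : ∀ v w, h v w = h' (A v) (A w)) : AlmostContactSpace φ' ξ' η' h' where
  phi_sq v := by
    obtain ⟨v, rfl⟩ := hA v
    rw [← hφ, ← hφ, hs.phi_sq, map_add, map_neg, map_smul, hξ, hη]
  eta_xi := by rw [← hξ, ← hη, hs.eta_xi]
  compat v w := by
    obtain ⟨v, rfl⟩ := hA v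
    obtain ⟨w, rfl⟩ := hA w
    rw [← hφ, ← hφ, ← hh, hs.compat, hη, hη, hh]
  symm v w := by
    obtain ⟨v, rfl⟩ := hA v
    obtain ⟨w, rfl⟩ := hA w
    rw [← hh, ← hh, hs.symm]

lemma IsRiemannianMetric.smoothBilinAt {g : BilinField I M} (hg : IsRiemannianMetric g) (x : M) :
    SmoothBilinAt g x := by
  obtain ⟨G, rfl⟩ := hg
  exact G.contMDiff x

lemma IsQuasiSasakian.exists_coordExpr [FiniteDimensional ℝ E] (hs : IsQuasiSasakian φ ξ η h)
    {f : M → E} {x : M} (hf : IsLocalDiffeomorphAt I 𝓘(ℝ, E) ∞ f x) :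
    ∃ φc ξc ηc hc, CoordExpr φ ξ η h f x φc ξc ηc hc := by
  have := FiniteDimensional.complete ℝ E
  obtain ⟨s, hl⟩ := exists_localInverse hf
  have hd := hl.diffeo_inv
  have key : ∃ (φc : EndField 𝓘(ℝ, E) E) (ξc : VField 𝓘(ℝ, E) E) (ηc : OneForm 𝓘(ℝ, E) E)
      (hc : BilinField 𝓘(ℝ, E) E), RelEnd I 𝓘(ℝ, E) f x φ φc ∧ RelField I 𝓘(ℝ, E) f x ξ ξc ∧
      RelForm I 𝓘(ℝ, E) f x η ηc ∧ RelBilin I 𝓘(ℝ, E) f x h hc ∧ SmoothEndAt φc (f x) ∧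
      SmoothFieldAt ξc (f x) ∧ SmoothOneFormAt ηc (f x) ∧ SmoothBilinAt hc (f x) :=
    ⟨_, _, _, _, (relEnd_pullEnd hd φ).symm hl.symm, (relField_mpullback hd ξ).symm hl.symm,
      (relForm_pullForm η).symm hl.symm, (relBilin_pullBilin h).symm hl.symm,
      (relEnd_pullEnd hd φ).smoothEndAt hd (hs.smooth_phi _),
      (relField_mpullback hd ξ).smoothFieldAt hd
        (hs.smooth_xi.smoothFieldAt isOpen_univ (Set.mem_univ _)),
      (relForm_pullForm η).smoothOneFormAt hd (hs.smooth_eta _),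
      (relBilin_pullBilin h).smoothBilinAt hd (hs.metric.smoothBilinAt _)⟩
  obtain ⟨φc, ξc, ηc, hc, rφ, rξ, rη, rh, sφ, sξ, sη, sh⟩ := key
  have cφ := smoothEndAt_iff_contDiffAt.1 sφ
  have cξ := smoothFieldAt_iff_contDiffAt.1 sξ
  have cη := smoothOneFormAt_iff_contDiffAt.1 sη
  have ch := smoothBilinAt_iff_contDiffAt.1 sh
  have hsp : ∀ᶠ z in 𝓝 (f x), AlmostContactSpace (V := E) (φc z) (ξc z) (ηc z) (hc z) := by
    refine hl.eventually_inv ?_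
    filter_upwards [rφ, rξ, rη, rh, eventually_isLocalDiffeomorphAt hf] with y h1 h2 h3 h4 h5 _
    exact (hs.toIsAlmostContactMetric.space y).transport (V := E) (W := E) (mfderiv I 𝓘(ℝ, E) f y)
      h5.isInvertible_mfderiv.surjective h1 h2 h3 h4
  -- the pull-backs of the constant fields are smooth on a neighbourhood of `x`
  obtain ⟨U, hU, hUo, hxU⟩ := mem_nhds_iff.1 (eventually_isLocalDiffeomorphAt hf)
  let C : E → VField 𝓘(ℝ, E) E := fun v _ => v
  have hC : ∀ v z, SmoothFieldAt (C v) z := fun v z =>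
    smoothFieldAt_iff_contDiffAt.2 contDiffAt_const
  have hCd : ∀ (v : E) (z : E), DifferentiableAt ℝ (fun _ : E => v) z := fun v z =>
    differentiableAt_const v
  have hP : ∀ v, SmoothOn (mpullback I 𝓘(ℝ, E) f (C v)) U := fun v =>
    smoothOn_mpullback (fun y hy => hU hy) fun y _ => hC v _
  have hR : ∀ v, RelField I 𝓘(ℝ, E) f x (mpullback I 𝓘(ℝ, E) f (C v)) (C v) := fun v =>
    relField_mpullback hf _
  refine ⟨φc, ξc, ηc, hc, hf, rφ, rξ, rη, rh, cφ, cξ, cη, ch, hsp,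
    normalJet_of_eventually cφ cξ cη hsp fun v w => ?_, fun u v w => ?_⟩
  · have h1 := hs.normal U hUo _ _ (hP v) (hP w) x hxU
    have h2 := congrArg (mfderiv I 𝓘(ℝ, E) f x) h1
    rw [map_add, map_smul, map_zero,
      nijenhuis_eq_of_related hf (hR v) (hR w) (hC v _) (hC w _) rφ sφ,
      dOne_eq_of_related hf (hR v) (hR w) (hC v _) (hC w _) rη sη, rξ.self_of_nhds] at h2
    have e1 := nijenhuis_vectorSpace (cφ.differentiableAt (by simp)) (hCd v _) (hCd w _)
    have e2 := dOne_vectorSpace (cη.differentiableAt (by simp)) (hCd v _) (hCd w _)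
    have aux : ∀ {a b e : E} {c d : ℝ}, a = b → c = d → b + d • e = a + c • e := by
      rintro _ _ _ _ _ rfl rfl
      rfl
    exact (aux (e := ξc (f x)) e1 e2).trans h2
  · have h1 := hs.closed U hUo _ _ _ (hP u) (hP v) (hP w) x hxU
    rw [dTwo_fundForm_eq_of_related hf (hR u) (hR v) (hC u _) (hC v _) (hR w) (hC w _) rφ sφ rh sh]
      at h1
    exact (dTwo_fundForm_vectorSpace cφ ch (fun a b => hsp.self_of_nhds.fund_anti a b)
      (hCd u _) (hCd v _) (hCd w _)).symm.trans h1

end Coordinates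

/-! ### The product with the real line -/

section ProductLine

variable {E : Type*} [NormedAddCommGroup E] [NormedSpace ℝ E]
  {H : Type*} [TopologicalSpace H] {I : ModelWithCorners ℝ E H}
  {M : Type*} [TopologicalSpace M] [ChartedSpace H M]

/-- The coordinates on `M × ℝ` given by coordinates `f` on `M` and by `t`. -/
def lineCoord (f : M → E) : M × ℝ → E × ℝ := fun p => (f p.1, p.2)

lemma isLocalDiffeomorphAt_lineCoord {f : M → E} {p : M × ℝ}
    (hf : IsLocalDiffeomorphAt I 𝓘(ℝ, E) ∞ f p.1) :
    IsLocalDiffeomorphAt (I.prod 𝓘(ℝ, ℝ)) 𝓘(ℝ, E × ℝ) ∞ (lineCoord f) p := by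
  obtain ⟨Φ, hx, hΦ⟩ := hf
  refine ⟨{ toPartialEquiv := Φ.toPartialEquiv.prod (PartialEquiv.refl ℝ)
            open_source := Φ.open_source.prod isOpen_univ
            open_target := Φ.open_target.prod isOpen_univ
            contMDiffOn_toFun := ?_
            contMDiffOn_invFun := ?_ }, ⟨hx, Set.mem_univ _⟩, fun y hy => ?_⟩
  · exact ContMDiffOn.prodMk_space
      (Φ.contMDiffOn_toFun.comp contMDiff_fst.contMDiffOn fun y hy => hy.1)
      contMDiff_snd.contMDiffOn
  · exact ContMDiffOn.prodMk
      (Φ.contMDiffOn_invFun.comp (contDiff_fst.contMDiff (E := E × ℝ)).contMDiffOn fun y hy => hy.1)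
      contDiff_snd.contMDiff.contMDiffOn
  · exact Prod.ext (hΦ hy.1) rfl

lemma mfderiv_lineCoord {f : M → E} {p : M × ℝ} (hf : IsLocalDiffeomorphAt I 𝓘(ℝ, E) ∞ f p.1)
    (v : E × ℝ) :
    (mfderiv (I.prod 𝓘(ℝ, ℝ)) 𝓘(ℝ, E × ℝ) (lineCoord f) p v : E × ℝ)
      = (mfderiv I 𝓘(ℝ, E) f p.1 v.1, v.2) := by
  have hd : MDifferentiableAt (I.prod 𝓘(ℝ, ℝ)) 𝓘(ℝ, E × ℝ) (lineCoord f) p :=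
    (isLocalDiffeomorphAt_lineCoord hf).mdifferentiableAt (by simp)
  have hp : HasMFDerivAt (I.prod 𝓘(ℝ, ℝ)) I (Prod.fst : M × ℝ → M) p
      (ContinuousLinearMap.fst ℝ (TangentSpace I p.1) (TangentSpace 𝓘(ℝ, ℝ) p.2)) :=
    hasMFDerivAt_fst p
  have h1 := HasMFDerivAt.comp p
    (ContinuousLinearMap.hasMFDerivAt (ContinuousLinearMap.fst ℝ E ℝ)) hd.hasMFDerivAt
  have h2 := HasMFDerivAt.comp p (hf.mdifferentiableAt (by simp)).hasMFDerivAt hp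
  have h3 := HasMFDerivAt.comp p
    (ContinuousLinearMap.hasMFDerivAt (ContinuousLinearMap.snd ℝ E ℝ)) hd.hasMFDerivAt
  have h4 : HasMFDerivAt (I.prod 𝓘(ℝ, ℝ)) 𝓘(ℝ, ℝ) (Prod.snd : M × ℝ → ℝ) p
      (ContinuousLinearMap.snd ℝ (TangentSpace I p.1) (TangentSpace 𝓘(ℝ, ℝ) p.2)) :=
    hasMFDerivAt_snd p
  refine Prod.ext ?_ ?_
  · exact congrArg (fun L : E × ℝ →L[ℝ] E => L v) (hasMFDerivAt_unique h1 h2)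
  · exact congrArg (fun L : E × ℝ →L[ℝ] ℝ => L v) (hasMFDerivAt_unique h3 h4)

lemma prodJ_apply (φ : EndField I M) (ξ : VField I M) (η : OneForm I M) (p : M × ℝ) (v : E × ℝ) :
    (prodJ φ ξ η p v : E × ℝ) = spaceJ (V := E) (φ p.1) (ξ p.1) (η p.1) v := by
  have h1 : (prodJ φ ξ η p v : E × ℝ)
      = ((φ p.1 v.1, 0) : E × ℝ) - (η p.1 v.1 : ℝ) • ((0, 1) : E × ℝ)
        + (v.2 : ℝ) • ((ξ p.1, 0) : E × ℝ) := rfl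
  have h2 : ∀ (a b : E) (c d : ℝ),
      ((a, 0) : E × ℝ) - c • ((0, 1) : E × ℝ) + d • ((b, 0) : E × ℝ) = (a + d • b, -c) := by
    intro a b c d
    ext <;> simp
  exact h1.trans (h2 _ _ _ _)

variable {φ : EndField I M} {ξ : VField I M} {η : OneForm I M} {h : BilinField I M}

section CoordExpr

variable {f : M → E} {φc : E → E →L[ℝ] E} {ξc : E → E} {ηc : E → E →L[ℝ] ℝ}
    {hc : E → E →L[ℝ] E →L[ℝ] ℝ} {p : M × ℝ}

lemma eventually_fst {P : M → Prop} (hP : ∀ᶠ x in 𝓝 p.1, P x) : ∀ᶠ y : M × ℝ in 𝓝 p, P y.1 :=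
  continuousAt_fst.eventually hP

variable (hc' : CoordExpr φ ξ η h f p.1 φc ξc ηc hc)
include hc'

lemma CoordExpr.relEnd_prodJ : RelEnd (I.prod 𝓘(ℝ, ℝ)) 𝓘(ℝ, E × ℝ) (lineCoord f) p
    (prodJ φ ξ η) (fun y => spaceJ (φc y.1) (ξc y.1) (ηc y.1)) := by
  filter_upwards [eventually_fst hc'.rel_phi, eventually_fst hc'.rel_xi,
    eventually_fst hc'.rel_eta, eventually_fst (eventually_isLocalDiffeomorphAt hc'.diffeo)]
    with y h1 h2 h3 h4 v
  have e1 := mfderiv_lineCoord h4 (prodJ φ ξ η y v)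
  have e2 := mfderiv_lineCoord h4 v
  refine e1.trans (Eq.trans ?_ (congrArg (spaceJ (φc (f y.1)) (ξc (f y.1)) (ηc (f y.1)))
    e2.symm))
  refine (congrArg (fun u : E × ℝ => ((mfderiv I 𝓘(ℝ, E) f y.1 u.1, u.2) : E × ℝ))
    (prodJ_apply φ ξ η y v)).trans ?_
  refine Prod.ext ?_ ?_
  · refine (map_add (mfderiv I 𝓘(ℝ, E) f y.1) (φ y.1 v.1) (v.2 • ξ y.1)).trans ?_
    refine congrArg₂ (fun a b : E => a + b) (h1 v.1) ?_
    exact (map_smul (mfderiv I 𝓘(ℝ, E) f y.1) v.2 (ξ y.1)).trans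
      (congrArg (fun w : E => (v.2 : ℝ) • w) h2)
  · exact congrArg (fun a : ℝ => -a) (h3 v.1)

lemma CoordExpr.relBilin_prodMetric : RelBilin (I.prod 𝓘(ℝ, ℝ)) 𝓘(ℝ, E × ℝ) (lineCoord f) p
    (prodMetric h) (fun y => spaceMetric (hc y.1)) := by
  filter_upwards [eventually_fst hc'.rel_metric,
    eventually_fst (eventually_isLocalDiffeomorphAt hc'.diffeo)] with y h1 h2 v w
  have e1 := mfderiv_lineCoord h2 v
  have e2 := mfderiv_lineCoord h2 w
  refine Eq.trans ?_ (congrArg₂ (fun a b : E × ℝ => spaceMetric (hc (f y.1)) a b) e1.symm e2.symm)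
  exact congrArg (fun a : ℝ => a + (v.2 : ℝ) * w.2) (h1 v.1 w.1)

lemma CoordExpr.relForm_dt : RelForm (I.prod 𝓘(ℝ, ℝ)) 𝓘(ℝ, E × ℝ) (lineCoord f) p
    (dt (I := I)) (fun _ => ContinuousLinearMap.snd ℝ E ℝ) := by
  filter_upwards [eventually_fst (eventually_isLocalDiffeomorphAt hc'.diffeo)] with y h2 v
  exact (congrArg Prod.snd (mfderiv_lineCoord h2 v)).symm

lemma CoordExpr.relForm_eta : RelForm (I.prod 𝓘(ℝ, ℝ)) 𝓘(ℝ, E × ℝ) (lineCoord f) p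
    (antiForm (dt (I := I)) (prodJ φ ξ η))
    (fun y => (ηc y.1) ∘L ContinuousLinearMap.fst ℝ E ℝ) := by
  filter_upwards [eventually_fst hc'.rel_eta,
    eventually_fst (eventually_isLocalDiffeomorphAt hc'.diffeo)] with y h1 h2 v
  have e2 := mfderiv_lineCoord h2 v
  have e3 : -(-(η y.1 v.1)) = η y.1 v.1 := neg_neg _
  exact ((congrArg (fun u : E × ℝ => -u.2) (prodJ_apply φ ξ η y v)).trans e3).trans
    <| (h1 v.1).trans (congrArg (fun a : E × ℝ => ηc (f y.1) a.1) e2.symm)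

lemma CoordExpr.relField_ddt : RelField (I.prod 𝓘(ℝ, ℝ)) 𝓘(ℝ, E × ℝ) (lineCoord f) p
    (ddt (I := I)) (fun _ => ((0, 1) : E × ℝ)) := by
  filter_upwards [eventually_fst (eventually_isLocalDiffeomorphAt hc'.diffeo)] with y h2
  refine (mfderiv_lineCoord h2 ((0, 1) : E × ℝ)).trans ?_
  exact Prod.ext (map_zero _) rfl

omit hc' in
lemma contDiffAt_spaceJ [FiniteDimensional ℝ E] {z : E} (hφ : ContDiffAt ℝ ∞ φc z)
    (hξ : ContDiffAt ℝ ∞ ξc z) (hη : ContDiffAt ℝ ∞ ηc z) :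
    ContDiffAt ℝ ∞ (fun y => spaceJ (φc y) (ξc y) (ηc y)) z := by
  refine contDiffAt_clm_of_apply fun v => ?_
  simp only [spaceJ_apply]
  exact ((hφ.clm_apply contDiffAt_const).add (contDiffAt_const.smul hξ)).prodMk
    (hη.clm_apply contDiffAt_const).neg

omit hc' in
lemma contDiffAt_spaceMetric [FiniteDimensional ℝ E] {z : E} (hh : ContDiffAt ℝ ∞ hc z) :
    ContDiffAt ℝ ∞ (fun y => spaceMetric (hc y)) z := by
  refine contDiffAt_clm_of_apply fun v => contDiffAt_clm_of_apply fun w => ?_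
  simp only [spaceMetric_apply]
  exact ((hh.clm_apply contDiffAt_const).clm_apply contDiffAt_const).add contDiffAt_const

omit hc' in
lemma fderiv_spaceJ [FiniteDimensional ℝ E] {z : E} (hφ : ContDiffAt ℝ ∞ φc z)
    (hξ : ContDiffAt ℝ ∞ ξc z) (hη : ContDiffAt ℝ ∞ ηc z) (w : E) :
    fderiv ℝ (fun y => spaceJ (φc y) (ξc y) (ηc y)) z w
      = spaceJ (fderiv ℝ φc z w) (fderiv ℝ ξc z w) (fderiv ℝ ηc z w) := by
  refine ContinuousLinearMap.ext fun v => ?_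
  rw [fderiv_clm_const ((contDiffAt_spaceJ hφ hξ hη).differentiableAt (by simp))]
  have dφ := hφ.differentiableAt (by simp)
  have dξ := hξ.differentiableAt (by simp)
  have dη := hη.differentiableAt (by simp)
  have h1 : HasFDerivAt (fun y => (φc y v.1 + v.2 • ξc y, -ηc y v.1)) _ z :=
    (((dφ.clm_apply (differentiableAt_const v.1)).hasFDerivAt.add
      (dξ.hasFDerivAt.const_smul v.2)).prodMk
      (dη.clm_apply (differentiableAt_const v.1)).hasFDerivAt.neg)
  have h2 : fderiv ℝ (fun y => spaceJ (φc y) (ξc y) (ηc y) v) z = _ := h1.fderiv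
  rw [h2, spaceJ_apply, fderiv_clm_const dφ, fderiv_clm_const dη]
  rfl

end CoordExpr

/-- The derivative of a function on `E × ℝ` which does not depend on the last variable. -/
lemma fderiv_comp_fst {F : Type*} [NormedAddCommGroup F] [NormedSpace ℝ F] {u : E → F} {z : E × ℝ}
    (hu : DifferentiableAt ℝ u z.1) (w : E × ℝ) :
    fderiv ℝ (fun y : E × ℝ => u y.1) z w = fderiv ℝ u z.1 w.1 := by
  have h : HasFDerivAt (fun y : E × ℝ => u y.1) _ z :=
    HasFDerivAt.comp z hu.hasFDerivAt hasFDerivAt_fst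
  rw [h.fderiv]
  rfl

/-! ### The equations of a quasi-Vaisman structure in the coordinates of the product -/

section PartOne

variable [FiniteDimensional ℝ E] {f : M → E} {φc : E → E →L[ℝ] E} {ξc : E → E}
  {ηc : E → E →L[ℝ] ℝ} {hc : E → E →L[ℝ] E →L[ℝ] ℝ} {p : M × ℝ}
  (hc' : CoordExpr φ ξ η h f p.1 φc ξc ηc hc)
include hc'

lemma CoordExpr.smoothEndAt_J : SmoothEndAt (I := 𝓘(ℝ, E × ℝ)) (M := E × ℝ)
    (fun y => spaceJ (φc y.1) (ξc y.1) (ηc y.1)) (lineCoord f p) :=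
  smoothEndAt_iff_contDiffAt.2 <| ContDiffAt.comp (lineCoord f p)
    (contDiffAt_spaceJ hc'.smooth_phi hc'.smooth_xi hc'.smooth_eta) contDiffAt_fst

lemma CoordExpr.smoothBilinAt_metric : SmoothBilinAt (I := 𝓘(ℝ, E × ℝ)) (M := E × ℝ)
    (fun y => spaceMetric (hc y.1)) (lineCoord f p) :=
  smoothBilinAt_iff_contDiffAt.2 <| ContDiffAt.comp (lineCoord f p)
    (contDiffAt_spaceMetric hc'.smooth_metric) contDiffAt_fst

lemma CoordExpr.smoothOneFormAt_eta : SmoothOneFormAt (I := 𝓘(ℝ, E × ℝ)) (M := E × ℝ)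
    (fun y => (ηc y.1) ∘L ContinuousLinearMap.fst ℝ E ℝ) (lineCoord f p) :=
  smoothOneFormAt_iff_contDiffAt.2 <|
    (ContDiffAt.comp (lineCoord f p) hc'.smooth_eta contDiffAt_fst).clm_comp contDiffAt_const

omit hc' in
lemma smoothOneFormAt_snd (z : E × ℝ) : SmoothOneFormAt (I := 𝓘(ℝ, E × ℝ)) (M := E × ℝ)
    (fun _ => ContinuousLinearMap.snd ℝ E ℝ) z :=
  smoothOneFormAt_iff_contDiffAt.2 contDiffAt_const

omit [FiniteDimensional ℝ E] hc' in
lemma smoothFieldAt_ddt (z : E × ℝ) : SmoothFieldAt (I := 𝓘(ℝ, E × ℝ)) (M := E × ℝ)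
    (fun _ => ((0, 1) : E × ℝ)) z :=
  smoothFieldAt_iff_contDiffAt.2 contDiffAt_const

lemma CoordExpr.fderiv_J (w v : E × ℝ) :
    fderiv ℝ (fun y : E × ℝ => spaceJ (φc y.1) (ξc y.1) (ηc y.1)) (lineCoord f p) w v
      = spaceJ (fderiv ℝ φc (f p.1) w.1) (fderiv ℝ ξc (f p.1) w.1) (fderiv ℝ ηc (f p.1) w.1) v := by
  have h1 : DifferentiableAt ℝ (fun y => spaceJ (φc y) (ξc y) (ηc y)) (lineCoord f p).1 :=
    (contDiffAt_spaceJ hc'.smooth_phi hc'.smooth_xi hc'.smooth_eta).differentiableAt (by simp)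
  rw [fderiv_comp_fst h1]
  exact congrArg (fun L : E × ℝ →L[ℝ] E × ℝ => L v)
    (fderiv_spaceJ hc'.smooth_phi hc'.smooth_xi hc'.smooth_eta w.1)

variable {X Y Z : E × ℝ → E × ℝ}

lemma CoordExpr.nijenhuis_J (hX : DifferentiableAt ℝ X (lineCoord f p))
    (hY : DifferentiableAt ℝ Y (lineCoord f p)) :
    (nijenhuis (I := 𝓘(ℝ, E × ℝ)) (M := E × ℝ) (fun y => spaceJ (φc y.1) (ξc y.1) (ηc y.1)) X Y
      (lineCoord f p) : E × ℝ) = 0 := by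
  refine (nijenhuis_vectorSpace (φ := fun y : E × ℝ => spaceJ (φc y.1) (ξc y.1) (ηc y.1))
    ((smoothEndAt_iff_contDiffAt.1 hc'.smoothEndAt_J).differentiableAt (by simp)) hX hY).trans ?_
  rw [hc'.fderiv_J, hc'.fderiv_J, hc'.fderiv_J, hc'.fderiv_J]
  exact hc'.jet.nijenhuis_spaceJ _ _

lemma CoordExpr.lieDerivEnd_ddt (hX : DifferentiableAt ℝ X (lineCoord f p)) :
    (lieDerivEnd (I := 𝓘(ℝ, E × ℝ)) (M := E × ℝ) (fun _ => ((0, 1) : E × ℝ))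
      (fun y => spaceJ (φc y.1) (ξc y.1) (ηc y.1)) X (lineCoord f p) : E × ℝ) = 0 := by
  refine (lieDerivEnd_vectorSpace (φ := fun y : E × ℝ => spaceJ (φc y.1) (ξc y.1) (ηc y.1))
    ((smoothEndAt_iff_contDiffAt.1 hc'.smoothEndAt_J).differentiableAt (by simp)) hX).trans ?_
  rw [hc'.fderiv_J]
  simp [spaceJ_apply]
  rfl

set_option synthInstance.maxHeartbeats 100000 in
lemma CoordExpr.lieDerivBilin_ddt (hX : DifferentiableAt ℝ X (lineCoord f p))
    (hY : DifferentiableAt ℝ Y (lineCoord f p)) :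
    lieDerivBilin (I := 𝓘(ℝ, E × ℝ)) (M := E × ℝ) (fun _ => ((0, 1) : E × ℝ))
      (fun y => spaceMetric (hc y.1)) X Y (lineCoord f p) = 0 := by
  have h1 : DifferentiableAt ℝ (fun y => spaceMetric (hc y)) (lineCoord f p).1 :=
    (contDiffAt_spaceMetric hc'.smooth_metric).differentiableAt (by simp)
  refine (lieDerivBilin_vectorSpace (g := fun y : E × ℝ => spaceMetric (hc y.1))
    ((smoothBilinAt_iff_contDiffAt.1 hc'.smoothBilinAt_metric).differentiableAt (by simp))
    hX hY).trans ?_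
  have h2 : fderiv ℝ (fun y : E × ℝ => spaceMetric (hc y.1)) (lineCoord f p) (0, 1) = 0 :=
    (fderiv_comp_fst (u := fun y => spaceMetric (hc y)) (z := lineCoord f p) h1
      ((0, 1) : E × ℝ)).trans (map_zero _)
  have h3 : fderiv ℝ (fun _ : E × ℝ => ((0, 1) : E × ℝ)) (lineCoord f p) = 0 := fderiv_const_apply _
  refine (congrArg₂ (· + ·) (congrArg₂ (· + ·)
    (congrArg (fun L : E × ℝ →L[ℝ] E × ℝ →L[ℝ] ℝ => L _ _) h2)
    (congrArg (fun L : E × ℝ →L[ℝ] E × ℝ => spaceMetric (hc (f p.1)) (L _) _) h3))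
    (congrArg (fun L : E × ℝ →L[ℝ] E × ℝ => spaceMetric (hc (f p.1)) _ (L _)) h3)).trans ?_
  simp

/-- `dΩ = dη ∧ dt` in coordinates, where `Ω = Φ + η ∧ dt`. -/
lemma CoordExpr.dTwo_fundForm (hX : DifferentiableAt ℝ X (lineCoord f p))
    (hY : DifferentiableAt ℝ Y (lineCoord f p)) (hZ : DifferentiableAt ℝ Z (lineCoord f p)) :
    dTwo (I := 𝓘(ℝ, E × ℝ)) (M := E × ℝ) (fundForm (I := 𝓘(ℝ, E × ℝ)) (M := E × ℝ)
      (fun y => spaceJ (φc y.1) (ξc y.1) (ηc y.1)) (fun y => spaceMetric (hc y.1))) X Y Z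
      (lineCoord f p)
      = dOneWedge (I := 𝓘(ℝ, E × ℝ)) (M := E × ℝ)
        (fun y => (ηc y.1) ∘L ContinuousLinearMap.fst ℝ E ℝ)
        (fun _ => ContinuousLinearMap.snd ℝ E ℝ) X Y Z (lineCoord f p) := by
  set z := lineCoord f p
  have dη : DifferentiableAt ℝ ηc z.1 := hc'.smooth_eta.differentiableAt (by simp)
  have dφ : DifferentiableAt ℝ φc z.1 := hc'.smooth_phi.differentiableAt (by simp)
  have dh : DifferentiableAt ℝ hc z.1 := hc'.smooth_metric.differentiableAt (by simp)
  have hF : ∀ a b c : E × ℝ,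
      fderiv ℝ (fun y : E × ℝ => spaceMetric (hc y.1) b (spaceJ (φc y.1) (ξc y.1) (ηc y.1) c)) z a
        = fderiv ℝ (fun y => hc y b.1 (φc y c.1)) z.1 a.1
          + c.2 * fderiv ℝ ηc z.1 a.1 b.1 - b.2 * fderiv ℝ ηc z.1 a.1 c.1 := by
    intro a b c
    have dF : DifferentiableAt ℝ (fun y => hc y b.1 (φc y c.1)) z.1 :=
      (dh.clm_apply (differentiableAt_const b.1)).clm_apply
        (dφ.clm_apply (differentiableAt_const c.1))
    have db : DifferentiableAt ℝ (fun y => ηc y b.1) z.1 :=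
      dη.clm_apply (differentiableAt_const b.1)
    have dc : DifferentiableAt ℝ (fun y => ηc y c.1) z.1 :=
      dη.clm_apply (differentiableAt_const c.1)
    have h1 : HasFDerivAt (fun y => hc y b.1 (φc y c.1) + c.2 * ηc y b.1 - b.2 * ηc y c.1) _ z.1 :=
      (dF.hasFDerivAt.add (db.hasFDerivAt.const_mul c.2)).sub (dc.hasFDerivAt.const_mul b.2)
    have h2 : (fun y : E × ℝ => spaceMetric (hc y.1) b (spaceJ (φc y.1) (ξc y.1) (ηc y.1) c))
        =ᶠ[𝓝 z] fun y => hc y.1 b.1 (φc y.1 c.1) + c.2 * ηc y.1 b.1 - b.2 * ηc y.1 c.1 :=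
      (continuousAt_fst.eventually hc'.space).mono fun y hy => hy.spaceFund b c
    rw [h2.fderiv_eq, fderiv_comp_fst h1.differentiableAt, h1.fderiv,
      fderiv_clm_const dη, fderiv_clm_const dη]
    rfl
  have hanti : ∀ u v : E × ℝ,
      spaceMetric (hc z.1) u (spaceJ (φc z.1) (ξc z.1) (ηc z.1) v)
        = -spaceMetric (hc z.1) v (spaceJ (φc z.1) (ξc z.1) (ηc z.1) u) := by
    intro u v
    have hs : AlmostContactSpace (φc z.1) (ξc z.1) (ηc z.1) (hc z.1) := hc'.jet.toAlmostContactSpace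
    rw [hs.spaceFund, hs.spaceFund, hs.fund_anti]
    ring
  have h1 := dTwo_fundForm_vectorSpace (φ := fun y : E × ℝ => spaceJ (φc y.1) (ξc y.1) (ηc y.1))
    (g := fun y : E × ℝ => spaceMetric (hc y.1)) (smoothEndAt_iff_contDiffAt.1 hc'.smoothEndAt_J)
    (smoothBilinAt_iff_contDiffAt.1 hc'.smoothBilinAt_metric) hanti hX hY hZ
  have hd : ∀ {A B : E × ℝ → E × ℝ}, DifferentiableAt ℝ A z → DifferentiableAt ℝ B z →
      dOne (I := 𝓘(ℝ, E × ℝ)) (M := E × ℝ) (fun y => (ηc y.1) ∘L ContinuousLinearMap.fst ℝ E ℝ)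
        A B z = fderiv ℝ ηc z.1 (A z).1 (B z).1 - fderiv ℝ ηc z.1 (B z).1 (A z).1 := by
    intro A B hA hB
    have dη' : DifferentiableAt ℝ (fun y : E × ℝ => ηc y.1 ∘L ContinuousLinearMap.fst ℝ E ℝ) z :=
      (smoothOneFormAt_iff_contDiffAt.1 hc'.smoothOneFormAt_eta).differentiableAt (by simp)
    have e : ∀ a b : E × ℝ, fderiv ℝ (fun y : E × ℝ => ηc y.1 ∘L ContinuousLinearMap.fst ℝ E ℝ) z
        a b = fderiv ℝ ηc z.1 a.1 b.1 := by
      intro a b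
      rw [fderiv_clm_const dη', fderiv_clm_const dη]
      exact fderiv_comp_fst (u := fun y => ηc y b.1) (dη.clm_apply (differentiableAt_const b.1)) a
    exact (dOne_vectorSpace dη' hA hB).trans (congrArg₂ (· - ·) (e _ _) (e _ _))
  refine h1.trans ?_
  rw [hF, hF, hF]
  unfold dOneWedge
  rw [hd hX hY, hd hY hZ, hd hZ hX]
  have h2 := hc'.closed (X z).1 (Y z).1 (Z z).1
  change _ = _ * (Z z).2 + _ * (X z).2 + _ * (Y z).2
  change fderiv ℝ _ z.1 _ + fderiv ℝ _ z.1 _ + fderiv ℝ _ z.1 _ = 0 at h2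
  linear_combination h2

end PartOne

end ProductLine

/-! ### Riemannian metrics on finite-dimensional manifolds -/

section Metric

/-- On a finite-dimensional space, the unit balls of a positive definite form are bounded. -/
lemma isVonNBounded_of_pos {V : Type*} [NormedAddCommGroup V] [NormedSpace ℝ V]
    [FiniteDimensional ℝ V] (b : V →L[ℝ] V →L[ℝ] ℝ) (hb : ∀ v, v ≠ 0 → 0 < b v v) :
    Bornology.IsVonNBounded ℝ {v : V | b v v < 1} := by
  have := FiniteDimensional.proper ℝ V
  obtain ⟨c, hc, hcb⟩ : ∃ c : ℝ, 0 < c ∧ ∀ v : V, ‖v‖ = 1 → c ≤ b v v := by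
    rcases (Metric.sphere (0 : V) 1).eq_empty_or_nonempty with he | hne
    · refine ⟨1, one_pos, fun v hv => ?_⟩
      have : v ∈ Metric.sphere (0 : V) 1 := by simpa using hv
      simp [he] at this
    · obtain ⟨v, hv, hm⟩ := (isCompact_sphere (0 : V) 1).exists_isMinOn hne
        (f := fun v => b v v)
        (b.continuous.clm_apply continuous_id).continuousOn
      refine ⟨b v v, hb v ?_, fun w hw => hm (by simpa using hw)⟩
      rintro rfl
      simp at hv
  rw [NormedSpace.isVonNBounded_iff, isBounded_iff_forall_norm_le]
  refine ⟨Real.sqrt c⁻¹, fun v hv => Real.le_sqrt_of_sq_le ?_⟩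
  rcases eq_or_ne v 0 with rfl | hv0
  · simpa using hc.le
  have hn : ‖v‖ ≠ 0 := norm_ne_zero_iff.2 hv0
  have h1 := hcb (‖v‖⁻¹ • v) (by rw [norm_smul, norm_inv, norm_norm, inv_mul_cancel₀ hn])
  simp only [map_smul, smul_apply, smul_eq_mul] at h1
  have hv' : b v v < 1 := hv
  have h2 : c * ‖v‖ ^ 2 ≤ b v v := by
    calc c * ‖v‖ ^ 2 ≤ ‖v‖⁻¹ * (‖v‖⁻¹ * b v v) * ‖v‖ ^ 2 := by gcongr
      _ = b v v := by field_simp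
  rw [← one_div, le_div_iff₀ hc]
  linarith

variable {E : Type*} [NormedAddCommGroup E] [NormedSpace ℝ E] [FiniteDimensional ℝ E]
  {H : Type*} [TopologicalSpace H] {I : ModelWithCorners ℝ E H}
  {M : Type*} [TopologicalSpace M] [ChartedSpace H M] [IsManifold I ∞ M]

lemma isRiemannianMetric_of_pos {g : BilinField I M}
    (hs : ∀ x (v w : TangentSpace I x), g x v w = g x w v)
    (hp : ∀ x (v : TangentSpace I x), v ≠ 0 → 0 < g x v v) (hg : ∀ x, SmoothBilinAt g x) :
    IsRiemannianMetric g :=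
  ⟨{ inner := g
     symm := hs
     pos := hp
     isVonNBounded := fun x => isVonNBounded_of_pos (V := E) (g x) (hp x)
     contMDiff := hg }, rfl⟩

omit [FiniteDimensional ℝ E] in
lemma IsRiemannianMetric.symm {g : BilinField I M} (hg : IsRiemannianMetric g) (x : M)
    (v w : TangentSpace I x) : g x v w = g x w v := by
  obtain ⟨G, rfl⟩ := hg
  exact G.symm x v w

omit [FiniteDimensional ℝ E] in
lemma IsRiemannianMetric.pos {g : BilinField I M} (hg : IsRiemannianMetric g) (x : M)
    (v : TangentSpace I x) (hv : v ≠ 0) : 0 < g x v v := by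
  obtain ⟨G, rfl⟩ := hg
  exact G.pos x v hv

end Metric

/-! ### The quasi-Vaisman structure on the product with the real line -/

section PartOne

variable {E : Type*} [NormedAddCommGroup E] [NormedSpace ℝ E] [FiniteDimensional ℝ E]
  {H : Type*} [TopologicalSpace H] {I : ModelWithCorners ℝ E H} [I.Boundaryless]
  {M : Type*} [TopologicalSpace M] [ChartedSpace H M] [IsManifold I ∞ M]
  {φ : EndField I M} {ξ : VField I M} {η : OneForm I M} {h : BilinField I M}

/-- Coordinates `f` on `M` near `p.1` with the expression of the structure in them; `lineCoord f`
then gives coordinates on `M × ℝ` near `p`. -/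
lemma IsQuasiSasakian.exists_lineCoord (hs : IsQuasiSasakian φ ξ η h) (p : M × ℝ) :
    ∃ f φc ξc ηc hc, CoordExpr φ ξ η h f p.1 φc ξc ηc hc :=
  ⟨_, hs.exists_coordExpr (isLocalDiffeomorphAt_extChartAt p.1)⟩

/-- The product of a quasi-Sasakian manifold with the real line is quasi-Vaisman. -/
theorem IsQuasiSasakian.isQuasiVaisman_prod (hs : IsQuasiSasakian φ ξ η h) :
    IsQuasiVaisman (prodJ φ ξ η) (prodMetric h) (dt (I := I) (M := M)) := by
  have hsp := fun p : M × ℝ => hs.toIsAlmostContactMetric.space p.1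
  refine { even_dim := ?_, smooth_J := fun p => ?_, metric := ?_, J_sq := fun p v => ?_,
           compat := fun p v w => ?_, integrable := ?_, smooth_theta := fun p => ?_,
           closed := ?_, d_fundForm := ?_, dual := ⟨ddt, ?_, ?_, ?_, ?_, ?_⟩ }
  · obtain ⟨n, hn⟩ := hs.odd_dim
    refine ⟨n, ?_⟩
    rw [Module.finrank_prod, hn, Module.finrank_self]
    ring
  · obtain ⟨f, φc, ξc, ηc, hc, H⟩ := hs.exists_lineCoord p
    exact H.relEnd_prodJ.smoothEndAt (isLocalDiffeomorphAt_lineCoord H.diffeo) H.smoothEndAt_J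
  · refine isRiemannianMetric_of_pos (fun p v w => ?_) (fun p v hv => ?_) (fun p => ?_)
    · exact congrArg₂ (· + ·) (hs.metric.symm p.1 v.1 w.1) (mul_comm v.2 w.2)
    · change 0 < h p.1 v.1 v.1 + v.2 * v.2
      rcases eq_or_ne v.1 0 with h1 | h1
      · have h2 : v.2 ≠ 0 := fun h2 => hv (Prod.ext h1 h2)
        have h3 : h p.1 v.1 v.1 = 0 := (congrArg (fun w : E => h p.1 w w) h1).trans (map_zero _)
        rw [h3, zero_add]
        exact mul_self_pos.2 h2
      · exact add_pos_of_pos_of_nonneg (hs.metric.pos p.1 v.1 h1) (mul_self_nonneg _)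
    · obtain ⟨f, φc, ξc, ηc, hc, H⟩ := hs.exists_lineCoord p
      exact H.relBilin_prodMetric.smoothBilinAt (isLocalDiffeomorphAt_lineCoord H.diffeo)
        H.smoothBilinAt_metric
  · exact (prodJ_apply φ ξ η p _).trans ((congrArg (spaceJ (V := E) (φ p.1) (ξ p.1) (η p.1))
      (prodJ_apply φ ξ η p v)).trans ((hsp p).spaceJ_sq v))
  · exact (congrArg₂ (fun a b : E × ℝ => spaceMetric (V := E) (h p.1) a b)
      (prodJ_apply φ ξ η p v) (prodJ_apply φ ξ η p w)).trans ((hsp p).spaceMetric_compat v w)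
  · intro U hU X Y hX hY p hp
    obtain ⟨f, φc, ξc, ηc, hc, H⟩ := hs.exists_lineCoord p
    have hd := isLocalDiffeomorphAt_lineCoord H.diffeo
    obtain ⟨X', rX, sX⟩ := exists_relField hd (hX.smoothFieldAt hU hp)
    obtain ⟨Y', rY, sY⟩ := exists_relField hd (hY.smoothFieldAt hU hp)
    refine hd.isInvertible_mfderiv.injective ?_
    rw [map_zero, nijenhuis_eq_of_related hd rX rY sX sY H.relEnd_prodJ H.smoothEndAt_J]
    exact H.nijenhuis_J ((smoothFieldAt_iff_contDiffAt.1 sX).differentiableAt (by simp))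
      ((smoothFieldAt_iff_contDiffAt.1 sY).differentiableAt (by simp))
  · obtain ⟨f, φc, ξc, ηc, hc, H⟩ := hs.exists_lineCoord p
    exact H.relForm_dt.smoothOneFormAt (isLocalDiffeomorphAt_lineCoord H.diffeo)
      (smoothOneFormAt_snd _)
  · intro U hU X Y hX hY p hp
    obtain ⟨f, φc, ξc, ηc, hc, H⟩ := hs.exists_lineCoord p
    have hd := isLocalDiffeomorphAt_lineCoord H.diffeo
    obtain ⟨X', rX, sX⟩ := exists_relField hd (hX.smoothFieldAt hU hp)
    obtain ⟨Y', rY, sY⟩ := exists_relField hd (hY.smoothFieldAt hU hp)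
    rw [dOne_eq_of_related hd rX rY sX sY H.relForm_dt (smoothOneFormAt_snd _)]
    refine (dOne_vectorSpace (η := fun _ => ContinuousLinearMap.snd ℝ E ℝ)
      (differentiableAt_const _)
      ((smoothFieldAt_iff_contDiffAt.1 sX).differentiableAt (by simp))
      ((smoothFieldAt_iff_contDiffAt.1 sY).differentiableAt (by simp))).trans ?_
    simp only [fderiv_fun_const, Pi.zero_apply]
    exact sub_self (0 : ℝ)
  · intro U hU X Y Z hX hY hZ p hp
    obtain ⟨f, φc, ξc, ηc, hc, H⟩ := hs.exists_lineCoord p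
    have hd := isLocalDiffeomorphAt_lineCoord H.diffeo
    obtain ⟨X', rX, sX⟩ := exists_relField hd (hX.smoothFieldAt hU hp)
    obtain ⟨Y', rY, sY⟩ := exists_relField hd (hY.smoothFieldAt hU hp)
    obtain ⟨Z', rZ, sZ⟩ := exists_relField hd (hZ.smoothFieldAt hU hp)
    rw [dTwo_fundForm_eq_of_related hd rX rY sX sY rZ sZ H.relEnd_prodJ H.smoothEndAt_J
      H.relBilin_prodMetric H.smoothBilinAt_metric]
    unfold dOneWedge
    rw [dOne_eq_of_related hd rX rY sX sY H.relForm_eta H.smoothOneFormAt_eta,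
      dOne_eq_of_related hd rY rZ sY sZ H.relForm_eta H.smoothOneFormAt_eta,
      dOne_eq_of_related hd rZ rX sZ sX H.relForm_eta H.smoothOneFormAt_eta,
      H.relForm_dt.self_of_nhds, H.relForm_dt.self_of_nhds, H.relForm_dt.self_of_nhds,
      rX.self_of_nhds, rY.self_of_nhds, rZ.self_of_nhds]
    exact H.dTwo_fundForm ((smoothFieldAt_iff_contDiffAt.1 sX).differentiableAt (by simp))
      ((smoothFieldAt_iff_contDiffAt.1 sY).differentiableAt (by simp))
      ((smoothFieldAt_iff_contDiffAt.1 sZ).differentiableAt (by simp))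
  · intro p _
    obtain ⟨f, φc, ξc, ηc, hc, H⟩ := hs.exists_lineCoord p
    exact (H.relField_ddt.smoothFieldAt (isLocalDiffeomorphAt_lineCoord H.diffeo)
      (smoothFieldAt_ddt _)).contMDiffWithinAt
  · intro p v
    change h p.1 (0 : E) v.1 + (1 : ℝ) * v.2 = v.2
    rw [one_mul, add_eq_right]
    exact congrArg (fun L : E →L[ℝ] ℝ => L v.1) (map_zero (h p.1))
  · intro p
    change h p.1 (0 : E) (0 : E) + (1 : ℝ) * 1 = 1
    rw [one_mul, add_eq_right]
    exact map_zero (h p.1 (0 : E))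
  · intro U hU X Y hX hY p hp
    obtain ⟨f, φc, ξc, ηc, hc, H⟩ := hs.exists_lineCoord p
    have hd := isLocalDiffeomorphAt_lineCoord H.diffeo
    obtain ⟨X', rX, sX⟩ := exists_relField hd (hX.smoothFieldAt hU hp)
    obtain ⟨Y', rY, sY⟩ := exists_relField hd (hY.smoothFieldAt hU hp)
    rw [lieDerivBilin_eq_of_related hd rX rY sX sY H.relField_ddt (smoothFieldAt_ddt _)
      H.relBilin_prodMetric H.smoothBilinAt_metric]
    exact H.lieDerivBilin_ddt ((smoothFieldAt_iff_contDiffAt.1 sX).differentiableAt (by simp))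
      ((smoothFieldAt_iff_contDiffAt.1 sY).differentiableAt (by simp))
  · intro U hU X hX p hp
    obtain ⟨f, φc, ξc, ηc, hc, H⟩ := hs.exists_lineCoord p
    have hd := isLocalDiffeomorphAt_lineCoord H.diffeo
    obtain ⟨X', rX, sX⟩ := exists_relField hd (hX.smoothFieldAt hU hp)
    refine hd.isInvertible_mfderiv.injective ?_
    rw [map_zero, lieDerivEnd_eq_of_related hd H.relField_ddt rX (smoothFieldAt_ddt _) sX
      H.relEnd_prodJ H.smoothEndAt_J]
    exact H.lieDerivEnd_ddt ((smoothFieldAt_iff_contDiffAt.1 sX).differentiableAt (by simp))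

end PartOne

/-! ### Quasi-Vaisman structures on quotients -/

section Transfer

variable {E : Type*} [NormedAddCommGroup E] [NormedSpace ℝ E]
  {H : Type*} [TopologicalSpace H] {I : ModelWithCorners ℝ E H}
  {M : Type*} [TopologicalSpace M] [ChartedSpace H M]
  {E' : Type*} [NormedAddCommGroup E'] [NormedSpace ℝ E']
  {H' : Type*} [TopologicalSpace H'] {I' : ModelWithCorners ℝ E' H'}
  {M' : Type*} [TopologicalSpace M'] [ChartedSpace H' M']
  {q : M → M'} {J : EndField I M} {g : BilinField I M} {θ : OneForm I M}

/-- Tensor fields descend along a surjective local diffeomorphism `q` if any two points in a fibre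
of `q` are exchanged by a map over `q` which preserves them. -/
theorem exists_isPullback (hq : IsLocalDiffeomorph I I' ∞ q) (hsurj : Function.Surjective q)
    (hdeck : ∀ x₁ x₂, q x₁ = q x₂ → ∃ τ : M → M, MDifferentiableAt I I τ x₁ ∧ τ x₁ = x₂ ∧
      q ∘ τ = q ∧ IsPullback τ J g θ J g θ) :
    ∃ (J' : EndField I' M') (g' : BilinField I' M') (θ' : OneForm I' M'),
      IsPullback q J g θ J' g' θ' := by
  have key : ∀ y : M', ∃ (A : TangentSpace I' y →L[ℝ] TangentSpace I' y)
      (G : TangentSpace I' y →L[ℝ] TangentSpace I' y →L[ℝ] ℝ) (T : TangentSpace I' y →L[ℝ] ℝ),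
      ∀ x, q x = y → ∀ v w : E,
        (mfderiv I I' q x (J x v) : E') = A (mfderiv I I' q x v : E') ∧
        g x v w = G (mfderiv I I' q x v : E') (mfderiv I I' q x w : E') ∧
        θ x v = T (mfderiv I I' q x v : E') := by
    intro y
    obtain ⟨x₀, rfl⟩ := hsurj y
    let D := mfderiv I I' q x₀
    refine ⟨D ∘L J x₀ ∘L D.inverse,
      ContinuousLinearMap.precomp ℝ D.inverse ∘L g x₀ ∘L D.inverse, θ x₀ ∘L D.inverse,
      fun x hx v w => ?_⟩
    obtain ⟨τ, hτ, rfl, hqτ, hp⟩ := hdeck x x₀ hx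
    have hc : ∀ v : E, (mfderiv I I' q x v : E') = D (mfderiv I I τ x v : E) := by
      intro v
      have h1 : mfderiv I I' (q ∘ τ) x = (mfderiv I I' q (τ x)).comp (mfderiv I I τ x) :=
        mfderiv_comp x ((hq (τ x)).mdifferentiableAt (by simp)) hτ
      have h2 : mfderiv I I' q x = mfderiv I I' (q ∘ τ) x :=
        Filter.EventuallyEq.mfderiv_eq (by rw [hqτ])
      exact congrArg (fun L : E →L[ℝ] E' => L v) (h2.trans h1)
    have hinv : ∀ v : E, (D.inverse (mfderiv I I' q x v : E') : E) = mfderiv I I τ x v := by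
      intro v
      refine (congrArg (fun w : E' => (D.inverse w : E)) (hc v)).trans ?_
      exact (hq (τ x)).isInvertible_mfderiv.inverse_apply_self _
    refine ⟨?_, ?_, ?_⟩
    · refine (hc (J x v)).trans ?_
      refine (congrArg (fun w : E => (D w : E')) (hp.J_eq x v)).trans ?_
      exact congrArg (fun w : E => (D (J (τ x) w) : E')) (hinv v).symm
    · refine (hp.g_eq x v w).trans ?_
      exact congrArg₂ (fun a b : E => g (τ x) a b) (hinv v).symm (hinv w).symm
    · refine (hp.theta_eq x v).trans ?_
      exact congrArg (fun a : E => θ (τ x) a) (hinv v).symm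
  choose A G T hA using key
  exact ⟨A, G, T, fun x v => (hA (q x) x rfl v v).1, fun x v w => (hA (q x) x rfl v w).2.1,
    fun x v => (hA (q x) x rfl v v).2.2⟩

variable [IsManifold I ∞ M] [IsManifold I' ∞ M'] [FiniteDimensional ℝ E] [FiniteDimensional ℝ E']
  {J' : EndField I' M'} {g' : BilinField I' M'} {θ' : OneForm I' M'}

omit [IsManifold I ∞ M] [IsManifold I' ∞ M'] [FiniteDimensional ℝ E] [FiniteDimensional ℝ E'] in
/-- The metric dual of `θ` descends along with `g` and `θ`. -/
lemma IsPullback.exists_dual (hp : IsPullback q J g θ J' g' θ')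
    (hq : IsLocalDiffeomorph I I' ∞ q) (hsurj : Function.Surjective q)
    (hpos : ∀ y (v : TangentSpace I' y), v ≠ 0 → 0 < g' y v v) {V : VField I M}
    (hV : ∀ x (v : TangentSpace I x), g x (V x) v = θ x v) :
    ∃ V' : VField I' M', ∀ x, mfderiv I I' q x (V x) = V' (q x) := by
  have key : ∀ x (w : TangentSpace I' (q x)), g' (q x) (mfderiv I I' q x (V x)) w = θ' (q x) w := by
    intro x w
    obtain ⟨v, hv⟩ := (hq x).isInvertible_mfderiv.surjective w
    have hv' : mfderiv I I' q x v = w := hv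
    subst hv'
    rw [← hp.theta_eq, ← hp.g_eq, hV]
  have hinj : ∀ y (a b : E'), (∀ w : E', g' y a w = g' y b w) → a = b := by
    intro y a b hab
    by_contra hne
    have h1 := hpos y (a - b) (sub_ne_zero.2 hne)
    have h2 : g' y (a - b) (a - b) = 0 := by
      have e := congrArg (fun L : E' →L[ℝ] ℝ => L (a - b)) (map_sub (g' y) a b)
      exact e.trans (sub_eq_zero.2 (hab (a - b)))
    exact h1.ne' h2
  have key2 : ∀ y : M', ∃ u : TangentSpace I' y, ∀ x, q x = y →
      (mfderiv I I' q x (V x) : E') = u := by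
    intro y
    obtain ⟨x₀, rfl⟩ := hsurj y
    refine ⟨mfderiv I I' q x₀ (V x₀), fun x hx => hinj (q x₀) _ _ fun w => ?_⟩
    refine Eq.trans ?_ (key x₀ w).symm
    have aux : ∀ y, q x = y → g' y (mfderiv I I' q x (V x) : E') w = θ' y w := by
      rintro _ rfl
      exact key x w
    exact aux _ hx
  choose V' hV' using key2
  exact ⟨V', fun x => hV' (q x) x rfl⟩

/-- A quasi-Vaisman structure descends along a surjective local diffeomorphism. -/
theorem IsQuasiVaisman.of_isPullback (hs : IsQuasiVaisman J g θ)
    (hp : IsPullback q J g θ J' g' θ') (hq : IsLocalDiffeomorph I I' ∞ q)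
    (hsurj : Function.Surjective q) (hE : Module.finrank ℝ E' = Module.finrank ℝ E) :
    IsQuasiVaisman J' g' θ' := by
  have := FiniteDimensional.complete ℝ E
  have := FiniteDimensional.complete ℝ E'
  have rJ : ∀ x, RelEnd I I' q x J J' := fun x => Filter.Eventually.of_forall hp.J_eq
  have rg : ∀ x, RelBilin I I' q x g g' := fun x => Filter.Eventually.of_forall hp.g_eq
  have rθ : ∀ x, RelForm I I' q x θ θ' := fun x => Filter.Eventually.of_forall hp.theta_eq
  have rη : ∀ x, RelForm I I' q x (antiForm θ J) (antiForm θ' J') := fun x =>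
    Filter.Eventually.of_forall fun y v => by
      change -(θ y (J y v)) = -(θ' (q y) (J' (q y) (mfderiv I I' q y v)))
      rw [hp.theta_eq, hp.J_eq]
  have sJ : ∀ x, SmoothEndAt J' (q x) := fun x => by
    obtain ⟨s, hl⟩ := exists_localInverse (hq x)
    exact ((rJ x).symm hl).smoothEndAt hl.diffeo_inv (hs.smooth_J _)
  have sg : ∀ x, SmoothBilinAt g' (q x) := fun x => by
    obtain ⟨s, hl⟩ := exists_localInverse (hq x)
    exact ((rg x).symm hl).smoothBilinAt hl.diffeo_inv (hs.metric.smoothBilinAt _)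
  have sθ : ∀ x, SmoothOneFormAt θ' (q x) := fun x => by
    obtain ⟨s, hl⟩ := exists_localInverse (hq x)
    exact ((rθ x).symm hl).smoothOneFormAt hl.diffeo_inv (hs.smooth_theta _)
  have sη : ∀ x, SmoothOneFormAt (antiForm θ' J') (q x) := fun x =>
    smoothOneFormAt_of_apply fun X hX =>
      ((sθ x).apply ((sJ x).apply hX)).neg
  have hsur : ∀ x (w : TangentSpace I' (q x)), ∃ v, mfderiv I I' q x v = w := fun x =>
    (hq x).isInvertible_mfderiv.surjective
  have hpos : ∀ y (v : TangentSpace I' y), v ≠ 0 → 0 < g' y v v := by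
    intro y v hv
    obtain ⟨x, rfl⟩ := hsurj y
    obtain ⟨v, rfl⟩ := hsur x v
    have h1 := hs.metric.pos x v fun h0 => hv <| by rw [h0]; exact map_zero _
    rwa [hp.g_eq] at h1
  obtain ⟨V, sV, hV, hV1, hVg, hVJ⟩ := hs.dual
  obtain ⟨V', hV'⟩ := hp.exists_dual hq hsurj hpos hV
  have rV : ∀ x, RelField I I' q x V V' := fun x => Filter.Eventually.of_forall hV'
  have sV' : ∀ x, SmoothFieldAt V' (q x) := fun x => by
    obtain ⟨s, hl⟩ := exists_localInverse (hq x)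
    exact ((rV x).symm hl).smoothFieldAt hl.diffeo_inv
      (sV.smoothFieldAt isOpen_univ (Set.mem_univ _))
  have hqc : Continuous q := continuous_iff_continuousAt.2 fun x => (hq x).contMDiffAt.continuousAt
  -- vector fields on the base are related to their pull-backs
  have hlift : ∀ {U : Set M'} {X : VField I' M'}, SmoothOn X U → IsOpen U →
      SmoothOn (mpullback I I' q X) (q ⁻¹' U) := fun hX hU =>
    smoothOn_mpullback (fun x _ => hq x) fun x hx => hX.smoothFieldAt hU hx
  have hrel : ∀ x (X : VField I' M'), RelField I I' q x (mpullback I I' q X) X := fun x X =>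
    relField_mpullback (hq x) X
  refine { even_dim := ?_, smooth_J := hsurj.forall.2 sJ, metric := ?_,
           J_sq := hsurj.forall.2 fun x v => ?_, compat := hsurj.forall.2 fun x v w => ?_,
           integrable := ?_, smooth_theta := hsurj.forall.2 sθ, closed := ?_, d_fundForm := ?_,
           dual := ⟨V', ?_, hsurj.forall.2 fun x v => ?_, hsurj.forall.2 fun x => ?_, ?_, ?_⟩ }
  · rw [hE]
    exact hs.even_dim
  · refine isRiemannianMetric_of_pos (hsurj.forall.2 fun x v w => ?_) hpos (hsurj.forall.2 sg)
    obtain ⟨v, rfl⟩ := hsur x v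
    obtain ⟨w, rfl⟩ := hsur x w
    rw [← hp.g_eq, ← hp.g_eq, hs.metric.symm]
  · obtain ⟨v, rfl⟩ := hsur x v
    rw [← hp.J_eq, ← hp.J_eq, hs.J_sq, map_neg]
  · obtain ⟨v, rfl⟩ := hsur x v
    obtain ⟨w, rfl⟩ := hsur x w
    rw [← hp.J_eq, ← hp.J_eq, ← hp.g_eq, ← hp.g_eq, hs.compat]
  · refine fun U hU X Y hX hY => hsurj.forall.2 fun x hx => ?_
    rw [← nijenhuis_eq_of_related (hq x) (hrel x X) (hrel x Y) (hX.smoothFieldAt hU hx)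
      (hY.smoothFieldAt hU hx) (rJ x) (sJ x),
      hs.integrable _ (hU.preimage hqc) _ _ (hlift hX hU) (hlift hY hU) x hx, map_zero]
  · refine fun U hU X Y hX hY => hsurj.forall.2 fun x hx => ?_
    rw [← dOne_eq_of_related (hq x) (hrel x X) (hrel x Y) (hX.smoothFieldAt hU hx)
      (hY.smoothFieldAt hU hx) (rθ x) (sθ x),
      hs.closed _ (hU.preimage hqc) _ _ (hlift hX hU) (hlift hY hU) x hx]
  · refine fun U hU X Y Z hX hY hZ => hsurj.forall.2 fun x hx => ?_
    have sX := hX.smoothFieldAt hU hx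
    have sY := hY.smoothFieldAt hU hx
    have sZ := hZ.smoothFieldAt hU hx
    rw [← dTwo_fundForm_eq_of_related (hq x) (hrel x X) (hrel x Y) sX sY (hrel x Z) sZ
      (rJ x) (sJ x) (rg x) (sg x), hs.d_fundForm _ (hU.preimage hqc) _ _ _ (hlift hX hU)
      (hlift hY hU) (hlift hZ hU) x hx]
    unfold dOneWedge
    rw [dOne_eq_of_related (hq x) (hrel x X) (hrel x Y) sX sY (rη x) (sη x),
      dOne_eq_of_related (hq x) (hrel x Y) (hrel x Z) sY sZ (rη x) (sη x),
      dOne_eq_of_related (hq x) (hrel x Z) (hrel x X) sZ sX (rη x) (sη x),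
      hp.theta_eq, hp.theta_eq, hp.theta_eq, mfderiv_mpullback (hq x), mfderiv_mpullback (hq x),
      mfderiv_mpullback (hq x)]
  · exact fun y _ => (hsurj.forall.2 sV' y).contMDiffWithinAt
  · obtain ⟨v, rfl⟩ := hsur x v
    rw [← hV', ← hp.g_eq, ← hp.theta_eq, hV]
  · rw [← hV', ← hp.g_eq, hV1]
  · refine fun U hU X Y hX hY => hsurj.forall.2 fun x hx => ?_
    rw [← lieDerivBilin_eq_of_related (hq x) (hrel x X) (hrel x Y) (hX.smoothFieldAt hU hx)
      (hY.smoothFieldAt hU hx) (rV x) (sV' x) (rg x) (sg x),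
      hVg _ (hU.preimage hqc) _ _ (hlift hX hU) (hlift hY hU) x hx]
  · refine fun U hU X hX => hsurj.forall.2 fun x hx => ?_
    rw [← lieDerivEnd_eq_of_related (hq x) (rV x) (hrel x X) (sV' x) (hX.smoothFieldAt hU hx)
      (rJ x) (sJ x), hVJ _ (hU.preimage hqc) _ (hlift hX hU) x hx, map_zero]

end Transfer

/-! ### Symmetries of the product with the real line -/

section Deck

variable {E : Type*} [NormedAddCommGroup E] [NormedSpace ℝ E]
  {H : Type*} [TopologicalSpace H] {I : ModelWithCorners ℝ E H}
  {M : Type*} [TopologicalSpace M] [ChartedSpace H M]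
  {φ : EndField I M} {ξ : VField I M} {η : OneForm I M} {h : BilinField I M}

lemma Preserves.id : Preserves (id : M → M) φ ξ η h where
  phi_eq x v := by rw [mfderiv_id]; rfl
  xi_eq x := by rw [mfderiv_id]; rfl
  eta_eq x v := by rw [mfderiv_id]; rfl
  h_eq x v w := by rw [mfderiv_id]; rfl

lemma Preserves.comp {f₁ f₂ : M → M} (h₁ : Preserves f₁ φ ξ η h) (h₂ : Preserves f₂ φ ξ η h)
    (hd₁ : MDifferentiable I I f₁) (hd₂ : MDifferentiable I I f₂) :
    Preserves (f₁ ∘ f₂) φ ξ η h := by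
  have hc : ∀ x (v : E), (mfderiv I I (f₁ ∘ f₂) x v : E)
      = mfderiv I I f₁ (f₂ x) (mfderiv I I f₂ x v : E) := fun x v =>
    congrArg (fun L : E →L[ℝ] E => L v) (mfderiv_comp x (hd₁ (f₂ x)) (hd₂ x))
  refine ⟨fun x v => ?_, fun x => ?_, fun x v => ?_, fun x v w => ?_⟩
  · refine (hc x (φ x v)).trans ?_
    refine (congrArg (fun w : E => (mfderiv I I f₁ (f₂ x) w : E)) (h₂.phi_eq x v)).trans ?_
    refine (h₁.phi_eq (f₂ x) (mfderiv I I f₂ x v)).trans ?_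
    exact congrArg (fun w : E => (φ (f₁ (f₂ x)) w : E)) (hc x v).symm
  · refine (hc x (ξ x)).trans ?_
    refine (congrArg (fun w : E => (mfderiv I I f₁ (f₂ x) w : E)) (h₂.xi_eq x)).trans ?_
    exact h₁.xi_eq (f₂ x)
  · refine (h₂.eta_eq x v).trans ((h₁.eta_eq (f₂ x) _).trans ?_)
    exact congrArg (fun w : E => η (f₁ (f₂ x)) w) (hc x v).symm
  · refine (h₂.h_eq x v w).trans ((h₁.h_eq (f₂ x) _ _).trans ?_)
    exact congrArg₂ (fun a b : E => h (f₁ (f₂ x)) a b) (hc x v).symm (hc x w).symm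

lemma Preserves.symm {f : M ≃ₘ^∞⟮I, I⟯ M} (hf : Preserves f φ ξ η h) :
    Preserves f.symm φ ξ η h := by
  have hl : ∀ x, LocalInverse I I f f.symm x (f x) := fun x =>
    ⟨rfl, f.symm_apply_apply x, f.isLocalDiffeomorph x, f.symm.isLocalDiffeomorph _,
      Filter.Eventually.of_forall f.symm_apply_apply,
      Filter.Eventually.of_forall f.apply_symm_apply⟩
  have r₁ : ∀ x, RelEnd I I f x φ φ := fun x => Filter.Eventually.of_forall hf.phi_eq
  have r₂ : ∀ x, RelField I I f x ξ ξ := fun x => Filter.Eventually.of_forall hf.xi_eq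
  have r₃ : ∀ x, RelForm I I f x η η := fun x => Filter.Eventually.of_forall hf.eta_eq
  have r₄ : ∀ x, RelBilin I I f x h h := fun x => Filter.Eventually.of_forall hf.h_eq
  refine ⟨f.surjective.forall.2 fun x => ?_, f.surjective.forall.2 fun x => ?_,
    f.surjective.forall.2 fun x => ?_, f.surjective.forall.2 fun x => ?_⟩
  · exact ((r₁ x).symm (hl x)).self_of_nhds
  · exact ((r₂ x).symm (hl x)).self_of_nhds
  · exact ((r₃ x).symm (hl x)).self_of_nhds
  · exact ((r₄ x).symm (hl x)).self_of_nhds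

/-- Integer powers of an automorphism of the structure are smooth and preserve the structure. -/
lemma Preserves.zpow {f : M ≃ₘ^∞⟮I, I⟯ M} (hf : Preserves f φ ξ η h) (k : ℤ) :
    ContMDiff I I ∞ (f.toEquiv ^ k : Equiv.Perm M) ∧
      Preserves (f.toEquiv ^ k : Equiv.Perm M) φ ξ η h := by
  have hd : ∀ {u : M → M}, ContMDiff I I ∞ u → MDifferentiable I I u := fun hu =>
    hu.mdifferentiable (by simp)
  have hf' : Preserves (f.toEquiv⁻¹ : Equiv.Perm M) φ ξ η h := hf.symm
  induction k with
  | zero => exact ⟨contMDiff_id, Preserves.id⟩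
  | succ n ih =>
    rw [zpow_add_one]
    exact ⟨ih.1.comp f.contMDiff, ih.2.comp hf (hd ih.1) (hd f.contMDiff)⟩
  | pred n ih =>
    rw [zpow_sub_one]
    exact ⟨ih.1.comp f.symm.contMDiff, ih.2.comp hf' (hd ih.1) (hd f.symm.contMDiff)⟩

/-- The map `(x, t) ↦ (f x, t + c)`. -/
def shift (f : M → M) (c : ℝ) : M × ℝ → M × ℝ := fun p => (f p.1, p.2 + c)

lemma contMDiff_shift {f : M → M} (hf : ContMDiff I I ∞ f) (c : ℝ) :
    ContMDiff (I.prod 𝓘(ℝ, ℝ)) (I.prod 𝓘(ℝ, ℝ)) ∞ (shift f c) :=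
  (hf.comp contMDiff_fst).prodMk
    ((contDiff_id.add contDiff_const).contMDiff.comp (contMDiff_snd (I := I) (J := 𝓘(ℝ, ℝ))))

lemma mfderiv_shift {f : M → M} (hf : ContMDiff I I ∞ f) (c : ℝ) (p : M × ℝ) (v : E × ℝ) :
    (mfderiv (I.prod 𝓘(ℝ, ℝ)) (I.prod 𝓘(ℝ, ℝ)) (shift f c) p v : E × ℝ)
      = (mfderiv I I f p.1 v.1, v.2) := by
  have h1 : HasMFDerivAt 𝓘(ℝ, ℝ) 𝓘(ℝ, ℝ) (fun t : ℝ => t + c) p.2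
      (ContinuousLinearMap.id ℝ ℝ) :=
    ((hasFDerivAt_id p.2).add_const c).hasMFDerivAt
  have h2 : mfderiv (I.prod 𝓘(ℝ, ℝ)) (I.prod 𝓘(ℝ, ℝ)) (shift f c) p
      = (mfderiv I I f p.1).prodMap (mfderiv 𝓘(ℝ, ℝ) 𝓘(ℝ, ℝ) (fun t : ℝ => t + c) p.2) :=
    mfderiv_prodMap (hf.mdifferentiableAt (by simp)) h1.mdifferentiableAt
  have h3 := congrArg (fun L : E × ℝ →L[ℝ] E × ℝ => L v) h2
  refine h3.trans (Prod.ext rfl ?_)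
  exact congrArg (fun L : ℝ →L[ℝ] ℝ => L v.2) h1.mfderiv

/-- The maps `(x, t) ↦ (f x, t + c)` preserve the structure on `M × ℝ` if `f` preserves the
structure on `M`. -/
lemma Preserves.isPullback_shift {f : M → M} (hp : Preserves f φ ξ η h)
    (hf : ContMDiff I I ∞ f) (c : ℝ) :
    IsPullback (shift f c) (prodJ φ ξ η) (prodMetric h) (dt (I := I))
      (prodJ φ ξ η) (prodMetric h) (dt (I := I)) := by
  refine ⟨fun p v => ?_, fun p v w => ?_, fun p v => ?_⟩
  · refine (mfderiv_shift hf c p (prodJ φ ξ η p v)).trans ?_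
    refine (congrArg (fun u : E × ℝ => ((mfderiv I I f p.1 u.1, u.2) : E × ℝ))
      (prodJ_apply φ ξ η p v)).trans ?_
    refine Eq.trans ?_ (prodJ_apply φ ξ η (shift f c p) _).symm
    refine Eq.trans ?_ (congrArg (spaceJ (V := E) (φ (f p.1)) (ξ (f p.1)) (η (f p.1)))
      (mfderiv_shift hf c p v)).symm
    refine Prod.ext ?_ ?_
    · refine (map_add (mfderiv I I f p.1) (φ p.1 v.1) (v.2 • ξ p.1)).trans ?_
      refine congrArg₂ (fun a b : E => a + b) (hp.phi_eq p.1 v.1) ?_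
      exact (map_smul (mfderiv I I f p.1) v.2 (ξ p.1)).trans
        (congrArg (fun w : E => (v.2 : ℝ) • w) (hp.xi_eq p.1))
    · exact congrArg (fun a : ℝ => -a) (hp.eta_eq p.1 v.1)
  · refine Eq.trans ?_ (congrArg₂ (fun a b : E × ℝ => spaceMetric (V := E) (h (f p.1)) a b)
      (mfderiv_shift hf c p v) (mfderiv_shift hf c p w)).symm
    exact congrArg (fun a : ℝ => a + (v.2 : ℝ) * w.2) (hp.h_eq p.1 v.1 w.1)
  · exact (congrArg Prod.snd (mfderiv_shift hf c p v)).symm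

end Deck

/-! ### Smooth quotients of manifolds -/

section QuotientManifold

variable {E : Type*} [NormedAddCommGroup E] [NormedSpace ℝ E]
  {H : Type*} [TopologicalSpace H] {I : ModelWithCorners ℝ E H}
  {M : Type*} [TopologicalSpace M] [ChartedSpace H M]
  {N : Type*} [TopologicalSpace N] {q : M → N}

/-- If the points in each fibre of a local homeomorphism `q` are exchanged by diffeomorphisms over
`q`, then the charts induced on the base are smoothly compatible: near any point, the transition
between two of them is the coordinate expression of such a diffeomorphism. -/
lemma isManifold_quotient [IsManifold I ∞ M] (hq : IsLocalHomeomorph q)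
    (hs : Function.Surjective q)
    (hdeck : ∀ x₁ x₂, q x₁ = q x₂ → ∃ τ : M ≃ₘ^∞⟮I, I⟯ M, τ x₁ = x₂ ∧ q ∘ τ = q) :
    letI : ChartedSpace H N := hq.chartedSpace hs
    IsManifold I ∞ N := by
  let : ChartedSpace H N := hq.chartedSpace hs
  refine isManifold_of_contDiffOn I ∞ N ?_
  rintro _ _ ⟨y₁, rfl⟩ ⟨y₂, rfl⟩
  set x₁ := hs.hasRightInverse.choose y₁
  set x₂ := hs.hasRightInverse.choose y₂
  rintro z ⟨hz, hzI⟩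
  obtain ⟨w, rfl⟩ := hzI
  simp only [Set.mem_preimage, I.left_inv] at hz
  -- the point of `M` with coordinates `w` in the first chart, and the point of `M` over the same
  -- point of `N` which is selected by the second chart
  let m := (chartAt H x₁).symm w
  let m' := hq.localInverseAt x₂ (q m)
  have hw : w ∈ (chartAt H x₁).target := hz.1.1
  have hm1 : m ∈ (hq.localInverseAt x₁).target := hz.1.2
  have hz2 : q m ∈ (hq.localInverseAt x₂).source ∧ m' ∈ (chartAt H x₂).source := by
    have := hz.2
    simpa [m, m'] using this
  have hqm : q m' = q m := hq.apply_localInverseAt_of_mem hz2.1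
  obtain ⟨τ, hτ, hqτ⟩ := hdeck m m' hqm.symm
  have hm' : m' ∈ (hq.localInverseAt x₂).target := (hq.localInverseAt x₂).map_source hz2.1
  have hloc : ∀ᶠ u in 𝓝 m, hq.localInverseAt x₂ (q u) = τ u := by
    have h1 : ∀ᶠ u in 𝓝 m, τ u ∈ (hq.localInverseAt x₂).target :=
      τ.continuous.continuousAt.eventually
        ((hq.localInverseAt x₂).open_target.mem_nhds (hτ ▸ hm'))
    filter_upwards [h1] with u hu
    have h2 := (hq.localInverseAt x₂).right_inv hu
    have h3 : q (τ u) = q u := congrFun hqτ u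
    rwa [congrFun (hq.localInverseAt_symm x₂), h3] at h2
  have hc1 : ContMDiffAt I I ∞ (chartAt H x₁).symm w :=
    contMDiffAt_symm_of_mem_maximalAtlas (IsManifold.chart_mem_maximalAtlas x₁) hw
  have hc2 : ContMDiffAt I I ∞ (chartAt H x₂) (τ m) :=
    contMDiffAt_of_mem_maximalAtlas (IsManifold.chart_mem_maximalAtlas x₂) (hτ ▸ hz2.2)
  have h4 : ContMDiffAt I 𝓘(ℝ, E) ∞ (fun u => I (chartAt H x₂ (τ ((chartAt H x₁).symm u)))) w :=
    I.contMDiff.contMDiffAt.comp w (hc2.comp w ((τ.contMDiff m).comp w hc1))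
  have h5 : ContMDiffWithinAt 𝓘(ℝ, E) I ∞ I.symm (Set.range I) (I w) :=
    I.contMDiffOn_symm _ ⟨w, rfl⟩
  have h6 : ContMDiffWithinAt 𝓘(ℝ, E) 𝓘(ℝ, E) ∞
      ((fun u => I (chartAt H x₂ (τ ((chartAt H x₁).symm u)))) ∘ I.symm) (Set.range I) (I w) :=
    ContMDiffAt.comp_contMDiffWithinAt (I w) (by rwa [I.left_inv]) h5
  refine (h6.contDiffWithinAt.mono Set.inter_subset_right).congr_of_eventuallyEq_of_mem ?_
    ⟨by simpa using hz, ⟨w, rfl⟩⟩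
  have h7 : Filter.Tendsto (fun v => (chartAt H x₁).symm (I.symm v)) (𝓝 (I w)) (𝓝 m) := by
    have h8 : ContinuousAt ((chartAt H x₁).symm ∘ I.symm) (I w) :=
      ContinuousAt.comp (by rw [I.left_inv]; exact hc1.continuousAt) I.continuous_symm.continuousAt
    have h9 := h8.tendsto
    rwa [Function.comp_apply, I.left_inv] at h9
  filter_upwards [(h7.eventually hloc).filter_mono nhdsWithin_le_nhds] with v hv
  simp only [Function.comp_apply, OpenPartialHomeomorph.coe_trans,
    OpenPartialHomeomorph.coe_trans_symm, hq.localInverseAt_symm]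
  rw [hv]

lemma isLocalDiffeomorph_quotient [IsManifold I ∞ M] (hq : IsLocalHomeomorph q)
    (hs : Function.Surjective q)
    (hdeck : ∀ x₁ x₂, q x₁ = q x₂ → ∃ τ : M ≃ₘ^∞⟮I, I⟯ M, τ x₁ = x₂ ∧ q ∘ τ = q) :
    letI : ChartedSpace H N := hq.chartedSpace hs
    IsLocalDiffeomorph I I ∞ q := by
  let : ChartedSpace H N := hq.chartedSpace hs
  have : IsManifold I ∞ N := isManifold_quotient hq hs hdeck
  intro x
  let x₀ := hs.hasRightInverse.choose (q x)
  have hx₀ : q x₀ = q x := hs.hasRightInverse.choose_spec (q x)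
  obtain ⟨τ, hτ, hqτ⟩ := hdeck x x₀ hx₀.symm
  have hc := IsManifold.chart_mem_maximalAtlas (I := I) (n := ∞) x₀
  have he := IsManifold.chart_mem_maximalAtlas (I := I) (n := ∞) (q x)
  have hloc : IsLocalDiffeomorphAt I I ∞ q x₀ := by
    refine ⟨{ toPartialEquiv := ((chartAt H x₀).trans (chartAt H (q x)).symm).toPartialEquiv
              open_source := OpenPartialHomeomorph.open_source _
              open_target := OpenPartialHomeomorph.open_target _
              contMDiffOn_toFun := ?_
              contMDiffOn_invFun := ?_ }, ?_, ?_⟩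
    · exact (contMDiffOn_symm_of_mem_maximalAtlas he).comp
        ((contMDiffOn_of_mem_maximalAtlas hc).mono fun y hy => hy.1) fun y hy => hy.2
    · exact (contMDiffOn_symm_of_mem_maximalAtlas hc).comp
        ((contMDiffOn_of_mem_maximalAtlas he).mono fun y hy => hy.1) fun y hy => hy.2
    · refine ⟨mem_chart_source H x₀, ?_⟩
      have h1 : chartAt H x₀ x₀ = chartAt H (q x) (q x) := by
        change _ = chartAt H x₀ (hq.localInverseAt x₀ (q x))
        rw [← hx₀, hq.localInverseAt_apply_self]
      change chartAt H x₀ x₀ ∈ (chartAt H (q x)).target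
      rw [h1]
      exact mem_chart_target H (q x)
    · intro y hy
      change q y = (hq.localInverseAt x₀).symm ((chartAt H x₀).symm (chartAt H x₀ y))
      rw [(chartAt H x₀).left_inv hy.1, hq.localInverseAt_symm]
  have := (τ.isLocalDiffeomorph x).comp _ _ (hτ.symm ▸ hloc : IsLocalDiffeomorphAt I I ∞ q (τ x))
  rwa [hqτ] at this

end QuotientManifold

/-! ### The product with a circle -/

section CircleProduct

lemma isLocalDiffeomorphAt_affine {c : ℝ} (hc : c ≠ 0) (d t : ℝ) :
    IsLocalDiffeomorphAt 𝓘(ℝ, ℝ) 𝓘(ℝ, ℝ) ∞ (fun t => c * t - d) t :=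
  ⟨{ toFun := fun t => c * t - d
     invFun := fun s => c⁻¹ * (s + d)
     source := Set.univ
     target := Set.univ
     map_source' := fun _ _ => Set.mem_univ _
     map_target' := fun _ _ => Set.mem_univ _
     left_inv' := fun s _ => by field_simp; ring
     right_inv' := fun s _ => by field_simp; ring
     open_source := isOpen_univ
     open_target := isOpen_univ
     contMDiffOn_toFun := ContDiff.contMDiff (by fun_prop) |>.contMDiffOn
     contMDiffOn_invFun := ContDiff.contMDiff (by fun_prop) |>.contMDiffOn }, Set.mem_univ _,
    fun _ _ => rfl⟩

lemma isLocalDiffeomorphAt_mul_circle (z w : Circle) :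
    IsLocalDiffeomorphAt (𝓡 1) (𝓡 1) ∞ (fun w => z * w) w :=
  ⟨{ toPartialEquiv := (Equiv.mulLeft z).toPartialEquiv
     open_source := isOpen_univ
     open_target := isOpen_univ
     contMDiffOn_toFun := ((contMDiff_mul_left (I := 𝓡 1) (n := ω) (a := z)).of_le
      le_top).contMDiffOn
     contMDiffOn_invFun := ((contMDiff_mul_left (I := 𝓡 1) (n := ω) (a := z⁻¹)).of_le
      le_top).contMDiffOn }, Set.mem_univ _, fun _ _ => rfl⟩

attribute [local instance] finrank_real_complex_fact'

lemma isLocalDiffeomorphAt_circleExp_zero :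
    IsLocalDiffeomorphAt 𝓘(ℝ, ℝ) (𝓡 1) ∞ Circle.exp 0 := by
  have hcoe : ContMDiff (𝓡 1) 𝓘(ℝ, ℂ) ∞ (fun z : Circle => (z : ℂ)) := contMDiff_coe_sphere
  refine ⟨{ toFun := Circle.exp
            invFun := fun z => Complex.arg z
            source := Set.Ioo (-Real.pi) Real.pi
            target := {z | (z : ℂ) ∈ Complex.slitPlane}
            map_source' := fun t ht => ?_
            map_target' := fun z hz => ?_
            left_inv' := fun t ht => Circle.arg_exp ht.1 ht.2.le
            right_inv' := fun z _ => Circle.exp_arg z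
            open_source := isOpen_Ioo
            open_target := Complex.isOpen_slitPlane.preimage hcoe.continuous
            contMDiffOn_toFun := contMDiff_circleExp.contMDiffOn
            contMDiffOn_invFun := fun z hz => ?_ },
    ⟨neg_lt_zero.2 Real.pi_pos, Real.pi_pos⟩, fun _ _ => rfl⟩
  · refine Complex.mem_slitPlane_iff_arg.2 ⟨?_, Circle.coe_ne_zero _⟩
    rw [Circle.arg_exp ht.1 ht.2.le]
    exact ht.2.ne
  · exact ⟨Complex.neg_pi_lt_arg _, lt_of_le_of_ne (Complex.arg_le_pi _)
      (Complex.mem_slitPlane_iff_arg.1 hz).1⟩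
  · have h1 : ContDiffAt ℝ ∞ (fun u : ℂ => (Complex.log u).im) z :=
      Complex.imCLM.contDiff.contDiffAt.comp (z : ℂ)
        ((Complex.contDiffAt_log hz).restrict_scalars ℝ)
    simp only [Complex.log_im] at h1
    exact (h1.contMDiffAt.comp z hcoe.contMDiffAt).contMDiffWithinAt

lemma isLocalDiffeomorphAt_circleExp_mul {c : ℝ} (hc : c ≠ 0) (t : ℝ) :
    IsLocalDiffeomorphAt 𝓘(ℝ, ℝ) (𝓡 1) ∞ (fun t => Circle.exp (c * t)) t := by
  have h0 : c * t - c * t = 0 := sub_self _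
  have h1 := ((isLocalDiffeomorphAt_affine hc (c * t) t).comp _ _
    (h0.symm ▸ isLocalDiffeomorphAt_circleExp_zero)).comp _ _
    (isLocalDiffeomorphAt_mul_circle (Circle.exp (c * t)) _)
  convert h1 using 1
  funext s
  simp only [Function.comp_apply, ← Circle.exp_add]
  congr 1
  ring

variable {E : Type*} [NormedAddCommGroup E] [NormedSpace ℝ E]
  {H : Type*} [TopologicalSpace H] {I : ModelWithCorners ℝ E H}
  {M : Type*} [TopologicalSpace M] [ChartedSpace H M]

lemma isLocalDiffeomorphAt_id_prod {E₁ E₂ H₁ H₂ N₁ N₂ : Type*}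
    [NormedAddCommGroup E₁] [NormedSpace ℝ E₁] [TopologicalSpace H₁] [TopologicalSpace N₁]
    [ChartedSpace H₁ N₁] {I₁ : ModelWithCorners ℝ E₁ H₁}
    [NormedAddCommGroup E₂] [NormedSpace ℝ E₂] [TopologicalSpace H₂] [TopologicalSpace N₂]
    [ChartedSpace H₂ N₂] {I₂ : ModelWithCorners ℝ E₂ H₂} {u : N₁ → N₂} {p : M × N₁}
    (hu : IsLocalDiffeomorphAt I₁ I₂ ∞ u p.2) :
    IsLocalDiffeomorphAt (I.prod I₁) (I.prod I₂) ∞ (fun p : M × N₁ => (p.1, u p.2)) p := by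
  obtain ⟨Φ, hx, hΦ⟩ := hu
  refine ⟨{ toPartialEquiv := (PartialEquiv.refl M).prod Φ.toPartialEquiv
            open_source := isOpen_univ.prod Φ.open_source
            open_target := isOpen_univ.prod Φ.open_target
            contMDiffOn_toFun := ?_
            contMDiffOn_invFun := ?_ }, ⟨Set.mem_univ _, hx⟩, fun y hy => ?_⟩
  · exact contMDiff_fst.contMDiffOn.prodMk
      (Φ.contMDiffOn_toFun.comp contMDiff_snd.contMDiffOn fun y hy => hy.2)
  · exact contMDiff_fst.contMDiffOn.prodMk
      (Φ.contMDiffOn_invFun.comp contMDiff_snd.contMDiffOn fun y hy => hy.2)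
  · exact Prod.ext rfl (hΦ hy.2)

variable {a : ℝ}

lemma isLocalDiffeomorph_circleProj (ha : 0 < a) :
    IsLocalDiffeomorph (I.prod 𝓘(ℝ, ℝ)) (I.prod (𝓡 1)) ∞ (circleProj (M := M) a) := by
  intro p
  have hc : 2 * Real.pi / a ≠ 0 := (div_pos Real.two_pi_pos ha).ne'
  have h1 := isLocalDiffeomorphAt_id_prod (I := I) (M := M) (p := p)
    (isLocalDiffeomorphAt_circleExp_mul hc p.2)
  have h2 : circleProj (M := M) a = fun p => (p.1, Circle.exp (2 * Real.pi / a * p.2)) := by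
    funext p
    rw [circleProj, mul_div_right_comm]
  rwa [h2]

lemma surjective_circleProj {M : Type*} (ha : 0 < a) :
    Function.Surjective (circleProj (M := M) a) := by
  rintro ⟨x, z⟩
  obtain ⟨s, rfl⟩ := Circle.exp_surjective z
  refine ⟨(x, a * s / (2 * Real.pi)), Prod.ext rfl ?_⟩
  have := Real.pi_pos
  simp only [circleProj]
  congr 1
  field_simp

lemma circleProj_eq_iff {M : Type*} (ha : 0 < a) (p q : M × ℝ) :
    circleProj a p = circleProj a q ↔ ∃ k : ℤ, q = (p.1, p.2 + k * a) := by
  have := Real.pi_pos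
  rw [circleProj, circleProj, Prod.mk.injEq, eq_comm (a := Circle.exp _), Circle.exp_eq_exp]
  constructor
  · rintro ⟨h1, k, hk⟩
    refine ⟨k, Prod.ext h1.symm ?_⟩
    field_simp at hk
    simp only
    linarith
  · rintro ⟨k, rfl⟩
    refine ⟨rfl, k, ?_⟩
    field_simp

end CircleProduct

/-! ### The topology of the mapping torus -/

section TorusTopology

variable {M : Type*} {f : Equiv.Perm M} {a : ℝ}

lemma surjective_torusProj : Function.Surjective (MappingTorus.proj f a) :=
  Quotient.mk_surjective

/-- The fibres of the projection are the orbits of `(x, t) ↦ (f^k x, t + k a)`. -/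
lemma torusProj_eq_iff {p p' : M × ℝ} : MappingTorus.proj f a p = MappingTorus.proj f a p' ↔
    ∃ k : ℤ, ((f ^ k) p.1, p.2 + k * a) = p' := by
  rw [eq_comm]
  exact Quotient.eq''

variable [TopologicalSpace M] (hf : ∀ k : ℤ, Continuous (f ^ k : Equiv.Perm M))

include hf in
lemma continuousConstVAdd_torusAction :
    letI := torusAction f a
    ContinuousConstVAdd ℤ (M × ℝ) :=
  letI := torusAction f a
  ⟨fun k => ((hf k).comp continuous_fst).prodMk (continuous_snd.add continuous_const)⟩

omit [TopologicalSpace M] in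
lemma isCancelVAdd_torusAction (ha : 0 < a) :
    letI := torusAction f a
    IsCancelVAdd ℤ (M × ℝ) :=
  letI := torusAction f a
  { left_cancel' := fun k p p' h => (AddAction.injective k) h
    right_cancel' := fun k l p h => by
      have h1 : p.2 + k * a = p.2 + l * a := congrArg Prod.snd h
      simpa [ha.ne'] using h1 }

/-- A translation by `k a` with `|k|` large moves a compact set away from another one. -/
lemma properlyDiscontinuousVAdd_torusAction (ha : 0 < a) :
    letI := torusAction f a
    ProperlyDiscontinuousVAdd ℤ (M × ℝ) := by
  let := torusAction f a
  refine ⟨fun {K L} hK hL => ?_⟩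
  obtain ⟨r, hr⟩ := ((hK.image continuous_snd).isBounded.union
    (hL.image continuous_snd).isBounded).exists_norm_le
  refine (Set.finite_Icc (-⌈2 * r / a⌉) ⌈2 * r / a⌉).subset ?_
  rintro k ⟨_, ⟨p, hp, rfl⟩, hL'⟩
  have h1 := abs_le.1 (hr p.2 (Or.inl ⟨p, hp, rfl⟩))
  have h2 := abs_le.1 (hr (p.2 + k * a) (Or.inr ⟨_, hL', rfl⟩))
  have h3 : (k : ℝ) ≤ 2 * r / a := by rw [le_div_iff₀ ha]; linarith
  have h4 : -(k : ℝ) ≤ 2 * r / a := by rw [le_div_iff₀ ha]; linarith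
  have h5 : (-k : ℤ) ≤ ⌈2 * r / a⌉ := by
    have := h4.trans (Int.le_ceil _)
    exact_mod_cast this
  refine ⟨by omega, ?_⟩
  have := h3.trans (Int.le_ceil _)
  exact_mod_cast this

include hf

lemma isLocalHomeomorph_torusProj [T2Space M] [LocallyCompactSpace M] (ha : 0 < a) :
    IsLocalHomeomorph (MappingTorus.proj f a) := by
  let := torusAction f a
  have := continuousConstVAdd_torusAction (a := a) hf
  have := isCancelVAdd_torusAction (f := f) ha
  have := properlyDiscontinuousVAdd_torusAction (f := f) ha
  exact isAddQuotientCoveringMap_quotientMk_of_properlyDiscontinuousVAdd (G := ℤ) (E := M × ℝ)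
    |>.isCoveringMap.isLocalHomeomorph

lemma t2Space_mappingTorus [T2Space M] [LocallyCompactSpace M] (ha : 0 < a) :
    T2Space (MappingTorus f a) := by
  let := torusAction f a
  have := continuousConstVAdd_torusAction (a := a) hf
  have := properlyDiscontinuousVAdd_torusAction (f := f) ha
  exact t2Space_of_properlyDiscontinuousVAdd_of_t2Space (Γ := ℤ) (T := M × ℝ)

lemma secondCountableTopology_mappingTorus [SecondCountableTopology M] :
    SecondCountableTopology (MappingTorus f a) := by
  let := torusAction f a
  have := continuousConstVAdd_torusAction (a := a) hf
  exact ContinuousConstVAdd.secondCountableTopology (Γ := ℤ) (T := M × ℝ)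

omit hf in
/-- The mapping torus is the image of the fundamental domain `M × [0, a]`. -/
lemma compactSpace_mappingTorus [CompactSpace M] (ha : 0 < a) :
    CompactSpace (MappingTorus f a) := by
  have hc : Continuous (MappingTorus.proj f a) := continuous_quot_mk
  refine ⟨?_⟩
  convert (isCompact_univ (X := M)).prod (isCompact_Icc (a := (0 : ℝ)) (b := a)) |>.image hc
  refine (Set.eq_univ_of_forall fun y => ?_).symm
  obtain ⟨p, rfl⟩ := surjective_torusProj y
  have h1 := Int.floor_le (p.2 / a)
  have h2 := Int.lt_floor_add_one (p.2 / a)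
  rw [le_div_iff₀ ha] at h1
  rw [div_lt_iff₀ ha] at h2
  refine ⟨((f ^ (-⌊p.2 / a⌋)) p.1, p.2 + (-⌊p.2 / a⌋ : ℤ) * a), ⟨Set.mem_univ _, ?_⟩,
    (torusProj_eq_iff.2 ⟨_, rfl⟩).symm⟩
  push_cast
  constructor <;> linarith

end TorusTopology

/-! ### Quasi-Vaisman structures on the circle product and on the mapping torus -/

section Quotients

variable {E : Type*} [NormedAddCommGroup E] [NormedSpace ℝ E]
  {H : Type*} [TopologicalSpace H] {I : ModelWithCorners ℝ E H}
  {M : Type*} [TopologicalSpace M] [ChartedSpace H M]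
  {φ : EndField I M} {ξ : VField I M} {η : OneForm I M} {h : BilinField I M}

/-- The diffeomorphism `(x, t) ↦ (f^k x, t + k a)` of `M × ℝ`. -/
def deckDiffeo (f : M ≃ₘ^∞⟮I, I⟯ M) (hf : ∀ k : ℤ, ContMDiff I I ∞ (f.toEquiv ^ k : Equiv.Perm M))
    (a : ℝ) (k : ℤ) : (M × ℝ) ≃ₘ^∞⟮I.prod 𝓘(ℝ, ℝ), I.prod 𝓘(ℝ, ℝ)⟯ (M × ℝ) where
  toFun := shift (f.toEquiv ^ k : Equiv.Perm M) (k * a)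
  invFun := shift (f.toEquiv ^ (-k) : Equiv.Perm M) (-(k * a))
  left_inv p := by
    refine Prod.ext ?_ (add_neg_cancel_right _ _)
    change (f.toEquiv ^ (-k)) ((f.toEquiv ^ k) p.1) = p.1
    rw [zpow_neg]
    exact Equiv.symm_apply_apply _ _
  right_inv p := by
    refine Prod.ext ?_ (neg_add_cancel_right _ _)
    change (f.toEquiv ^ k) ((f.toEquiv ^ (-k)) p.1) = p.1
    rw [zpow_neg]
    exact Equiv.apply_symm_apply _ _
  contMDiff_toFun := contMDiff_shift (hf k) _
  contMDiff_invFun := contMDiff_shift (hf (-k)) _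

variable [IsManifold I ∞ M] [FiniteDimensional ℝ E] [I.Boundaryless]

/-- A quotient of `M × ℝ` by the maps `(x, t) ↦ (f x, t + c)`, where `f` preserves the
quasi-Sasakian structure, is quasi-Vaisman. -/
theorem IsQuasiSasakian.exists_isQuasiVaisman_quotient (hs : IsQuasiSasakian φ ξ η h)
    {E' H' N : Type*} [NormedAddCommGroup E'] [NormedSpace ℝ E'] [FiniteDimensional ℝ E']
    [TopologicalSpace H'] {I' : ModelWithCorners ℝ E' H'} [TopologicalSpace N] [ChartedSpace H' N]
    [IsManifold I' ∞ N] {q : M × ℝ → N} (hq : IsLocalDiffeomorph (I.prod 𝓘(ℝ, ℝ)) I' ∞ q)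
    (hsurj : Function.Surjective q) (hE : Module.finrank ℝ E' = Module.finrank ℝ (E × ℝ))
    (hdeck : ∀ p p', q p = q p' → ∃ (f : M → M) (c : ℝ), ContMDiff I I ∞ f ∧
      Preserves f φ ξ η h ∧ shift f c p = p' ∧ q ∘ shift f c = q) :
    ∃ (J : EndField I' N) (g : BilinField I' N) (θ : OneForm I' N), IsQuasiVaisman J g θ ∧
      IsPullback q (prodJ φ ξ η) (prodMetric h) (dt (I := I)) J g θ := by
  obtain ⟨J, g, θ, hp⟩ := exists_isPullback (J := prodJ φ ξ η) (g := prodMetric h)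
    (θ := dt (I := I)) hq hsurj fun p p' hpp' => by
      obtain ⟨f, c, hf, hfp, h1, h2⟩ := hdeck p p' hpp'
      exact ⟨shift f c, (contMDiff_shift hf c).mdifferentiableAt (by simp), h1, h2,
        hfp.isPullback_shift hf c⟩
  exact ⟨J, g, θ, hs.isQuasiVaisman_prod.of_isPullback hp hq hsurj hE, hp⟩

end Quotients

end QuasiVaisman

end

theorem mainTheorem9
    {E : Type*} [NormedAddCommGroup E] [NormedSpace ℝ E] [FiniteDimensional ℝ E]
    {M : Type*} [TopologicalSpace M] [ChartedSpace E M] [IsManifold 𝓘(ℝ, E) ∞ M]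
    [T2Space M] [SecondCountableTopology M]
    (φ : QuasiVaisman.EndField 𝓘(ℝ, E) M) (ξ : QuasiVaisman.VField 𝓘(ℝ, E) M)
    (η : QuasiVaisman.OneForm 𝓘(ℝ, E) M) (h : QuasiVaisman.BilinField 𝓘(ℝ, E) M)
    (hqs : QuasiVaisman.IsQuasiSasakian φ ξ η h) :
    -- the product with the real line
    QuasiVaisman.IsQuasiVaisman (QuasiVaisman.prodJ φ ξ η) (QuasiVaisman.prodMetric h)
      QuasiVaisman.dt ∧
    -- the product with a circle, as the quotient of `M × ℝ` by the translation by `a`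
    (∀ a : ℝ, 0 < a →
      IsLocalDiffeomorph (𝓘(ℝ, E).prod 𝓘(ℝ, ℝ)) (𝓘(ℝ, E).prod (𝓡 1)) ∞
        (QuasiVaisman.circleProj (M := M) a) ∧
      Function.Surjective (QuasiVaisman.circleProj (M := M) a) ∧
      (∀ p q : M × ℝ, QuasiVaisman.circleProj a p = QuasiVaisman.circleProj a q ↔
        ∃ k : ℤ, q = (p.1, p.2 + k * a)) ∧
      ∃ (J : QuasiVaisman.EndField (𝓘(ℝ, E).prod (𝓡 1)) (M × Circle))
        (g : QuasiVaisman.BilinField (𝓘(ℝ, E).prod (𝓡 1)) (M × Circle))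
        (θ : QuasiVaisman.OneForm (𝓘(ℝ, E).prod (𝓡 1)) (M × Circle)),
        QuasiVaisman.IsQuasiVaisman J g θ ∧
        QuasiVaisman.IsPullback (QuasiVaisman.circleProj a)
          (QuasiVaisman.prodJ φ ξ η) (QuasiVaisman.prodMetric h) QuasiVaisman.dt J g θ) ∧
    -- mapping tori
    (∀ f : M ≃ₘ^∞⟮𝓘(ℝ, E), 𝓘(ℝ, E)⟯ M, QuasiVaisman.Preserves f φ ξ η h →
      ∀ a : ℝ, 0 < a →
      T2Space (QuasiVaisman.MappingTorus f.toEquiv a) ∧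
      SecondCountableTopology (QuasiVaisman.MappingTorus f.toEquiv a) ∧
      (CompactSpace M → CompactSpace (QuasiVaisman.MappingTorus f.toEquiv a)) ∧
      ∃ (_ : ChartedSpace (ModelProd E ℝ) (QuasiVaisman.MappingTorus f.toEquiv a))
        (_ : IsManifold (𝓘(ℝ, E).prod 𝓘(ℝ, ℝ)) ∞ (QuasiVaisman.MappingTorus f.toEquiv a)),
        IsLocalDiffeomorph (𝓘(ℝ, E).prod 𝓘(ℝ, ℝ)) (𝓘(ℝ, E).prod 𝓘(ℝ, ℝ)) ∞
          (QuasiVaisman.MappingTorus.proj f.toEquiv a) ∧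
        ∃ (J : QuasiVaisman.EndField (𝓘(ℝ, E).prod 𝓘(ℝ, ℝ))
            (QuasiVaisman.MappingTorus f.toEquiv a))
          (g : QuasiVaisman.BilinField (𝓘(ℝ, E).prod 𝓘(ℝ, ℝ))
            (QuasiVaisman.MappingTorus f.toEquiv a))
          (θ : QuasiVaisman.OneForm (𝓘(ℝ, E).prod 𝓘(ℝ, ℝ))
            (QuasiVaisman.MappingTorus f.toEquiv a)),
          QuasiVaisman.IsQuasiVaisman J g θ ∧
          QuasiVaisman.IsPullback (QuasiVaisman.MappingTorus.proj f.toEquiv a)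
            (QuasiVaisman.prodJ φ ξ η) (QuasiVaisman.prodMetric h) QuasiVaisman.dt J g θ) := by
  have : LocallyCompactSpace M := ChartedSpace.locallyCompactSpace E M
  refine ⟨hqs.isQuasiVaisman_prod, fun a ha => ?_, fun f hf a ha => ?_⟩
  · have hq := QuasiVaisman.isLocalDiffeomorph_circleProj (I := 𝓘(ℝ, E)) (M := M) ha
    have hsurj := QuasiVaisman.surjective_circleProj (M := M) ha
    refine ⟨hq, hsurj, QuasiVaisman.circleProj_eq_iff ha, ?_⟩
    refine hqs.exists_isQuasiVaisman_quotient hq hsurj ?_ fun p p' hpp' => ?_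
    · rw [Module.finrank_prod, Module.finrank_prod, finrank_euclideanSpace, Fintype.card_fin,
        Module.finrank_self]
    · obtain ⟨k, rfl⟩ := (QuasiVaisman.circleProj_eq_iff ha p p').1 hpp'
      exact ⟨id, k * a, contMDiff_id, QuasiVaisman.Preserves.id, rfl, funext fun p =>
        ((QuasiVaisman.circleProj_eq_iff ha p _).2 ⟨k, rfl⟩).symm⟩
  · have hk := hf.zpow
    have hkc : ∀ k : ℤ, Continuous (f.toEquiv ^ k : Equiv.Perm M) := fun k => (hk k).1.continuous
    have hq := QuasiVaisman.isLocalHomeomorph_torusProj hkc ha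
    have hsurj := QuasiVaisman.surjective_torusProj (f := f.toEquiv) (a := a)
    have hinv : ∀ k : ℤ, QuasiVaisman.MappingTorus.proj f.toEquiv a ∘
        QuasiVaisman.shift (f.toEquiv ^ k : Equiv.Perm M) (k * a)
          = QuasiVaisman.MappingTorus.proj f.toEquiv a := fun k => funext fun p =>
      (QuasiVaisman.torusProj_eq_iff.2 ⟨k, rfl⟩).symm
    have hdeck : ∀ p p', QuasiVaisman.MappingTorus.proj f.toEquiv a p
        = QuasiVaisman.MappingTorus.proj f.toEquiv a p' →
        ∃ τ : (M × ℝ) ≃ₘ^∞⟮𝓘(ℝ, E).prod 𝓘(ℝ, ℝ), 𝓘(ℝ, E).prod 𝓘(ℝ, ℝ)⟯ (M × ℝ), τ p = p' ∧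
          QuasiVaisman.MappingTorus.proj f.toEquiv a ∘ τ
            = QuasiVaisman.MappingTorus.proj f.toEquiv a := fun p p' hpp' => by
      obtain ⟨k, rfl⟩ := QuasiVaisman.torusProj_eq_iff.1 hpp'
      exact ⟨QuasiVaisman.deckDiffeo f (fun k => (hk k).1) a k, rfl, hinv k⟩
    refine ⟨QuasiVaisman.t2Space_mappingTorus hkc ha,
      QuasiVaisman.secondCountableTopology_mappingTorus hkc,
      fun _ => QuasiVaisman.compactSpace_mappingTorus ha, hq.chartedSpace hsurj,
      QuasiVaisman.isManifold_quotient hq hsurj hdeck,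
      QuasiVaisman.isLocalDiffeomorph_quotient hq hsurj hdeck, ?_⟩
    let := hq.chartedSpace (H := ModelProd E ℝ) hsurj
    have := QuasiVaisman.isManifold_quotient (I := 𝓘(ℝ, E).prod 𝓘(ℝ, ℝ)) hq hsurj hdeck
    refine hqs.exists_isQuasiVaisman_quotient
      (QuasiVaisman.isLocalDiffeomorph_quotient hq hsurj hdeck) hsurj rfl fun p p' hpp' => ?_
    obtain ⟨k, rfl⟩ := QuasiVaisman.torusProj_eq_iff.1 hpp'
    exact ⟨_, k * a, (hk k).1, (hk k).2, rfl, hinv k⟩
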